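/- Let $u,d\in(0,1)$, $U=\frac{u}{u+d}$. Let $\{X_t(x): t\ge 1\}$, $x\in\mathbb Z$, be independent copies of the stationary Markov chain on $\{0,1\}$ with $P[X_{t+1}=1\mid X_t=0]=u$, $P[X_{t+1}=0\mid X_t=1]=d$ and $P[X_1=1]=U$. Define $M_1(x)=X_1(x)$ and $M_t(x)=X_t(x)\,[M_{t-1}(x+1)+1]$ for $t\ge 2$, and put $M_t=M_t(1)$. For $x\ge1$ let $Z_t(x)=X_{t+1-x}(x)$ if $x\le t$ and $Z_t(x)=0$ if $x>t$, and let $\underline Z_t=(Z_t(1),Z_t(2),\dots)$. With $\mathrm H$ denoting (conditional) Shannon entropy, define $$\mathscr H(M)=\lim_{t\to\infty}\tfrac1t\,\mathrm H(M_t,\dots,M_1),$$ and, for every integer $j\ge1$, $$\mathscr U_j=\lim_{t\to\infty}\mathrm H(M_t\mid M_{t-1},\dots,M_{t-j+1}),\qquad \mathscr L_j=\lim_{t\to\infty}\mathrm H(M_t\mid M_{t-1},\dots,M_{t-j+1},\underline Z_{t-j}).$$ Then all these limits exist, and there is a finite constant $C=C(u,d)$ such that for all $j\ge1$ $$\mathscr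 L_j\le\mathscr H(M)\le\mathscr U_j\qquad\text{and}\qquad \mathscr U_j-\mathscr L_j\le C\,|1-u-d|^{j}.$$ In particular both bounds converge exponentially fast to $\mathscr H(M)$. -/

import Mathlib

open MeasureTheory ProbabilityTheory Filter Topology

noncomputable section

namespace LinearNetwork

/-! ### Shannon entropy of discrete random variables (natural logarithm)

The definitions below are used only for random variables with finitely many values, so that all
the sums have finitely many nonzero terms. -/

section Entropy

variable {Ω : Type*} [MeasurableSpace Ω] {S T : Type*}

/-- `H(X) = - ∑ₓ P[X = x] log P[X = x]`. -/
def entropy (P : Measure Ω) (X : Ω → S) : ℝ :=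
  - ∑' x : S, P.real {ω | X ω = x} * Real.log (P.real {ω | X ω = x})

/-- `H(X | Y) = - ∑ₓ,ᵧ P[X = x, Y = y] log P[X = x | Y = y]`. Terms with `P[Y = y] = 0` vanish,
since then also `P[X = x, Y = y] = 0`. -/
def condEntropy (P : Measure Ω) (X : Ω → S) (Y : Ω → T) : ℝ :=
  - ∑' p : S × T, P.real {ω | X ω = p.1 ∧ Y ω = p.2} *
      Real.log (P.real {ω | X ω = p.1 ∧ Y ω = p.2} / P.real {ω | Y ω = p.2})

end Entropy

/-! ### The links -/

/-- The law on `{0, 1}` (`true = 1 =` open, `false = 0 =` closed) that gives mass `q` to `1` and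
`1 - q` to `0`. A real number outside `[0, 1]`, which never occurs below for `u, d ∈ (0, 1)`,
is first projected to `[0, 1]`. -/
def coin (q : ℝ) : Measure Bool :=
  bernoulliMeasure true false (Set.projIcc (0 : ℝ) 1 zero_le_one q)

instance (q : ℝ) : IsProbabilityMeasure (coin q) := by
  unfold coin; infer_instance

/-- The transition kernel of one link: from `1` it moves to `1` with probability `1 - d` (and to
`0` with probability `d`), from `0` it moves to `1` with probability `u`. -/
def step (u d : ℝ) : Kernel Bool Bool :=
  Kernel.ofFunOfCountable fun a => coin (if a then 1 - d else u)

instance (u d : ℝ) : IsMarkovKernel (step u d) :=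
  ⟨fun a => inferInstanceAs (IsProbabilityMeasure (coin (if a then 1 - d else u)))⟩

/-- The law of the history of one link: the Markov chain with transition kernel `step u d` started
from its stationary law, which gives mass `u / (u + d)` to `1`. Coordinate `n` of a path is the
state at time `n + 1`, the initial time being `1`. -/
def linkLaw (u d : ℝ) : Measure (ℕ → Bool) :=
  Kernel.trajMeasure (X := fun _ => Bool) (coin (u / (u + d)))
    fun n => (step u d).comap (fun h : (i : Finset.Iic n) → Bool => h ⟨n, Finset.mem_Iic.2 le_rfl⟩)
      (measurable_pi_apply _)

instance (u d : ℝ) : IsProbabilityMeasure (linkLaw u d) := by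
  unfold linkLaw; infer_instance

/-- The sample space: one path for each link `x ∈ ℤ`. -/
abbrev Sample : Type := ℤ → ℕ → Bool

/-- The law of the network: the links are independent with law `linkLaw u d`. -/
def netLaw (u d : ℝ) : Measure Sample := Measure.infinitePi fun _ : ℤ => linkLaw u d

/-- `X_t(x)`, the state of link `x` at time `t ≥ 1`. -/
def X (t : ℕ) (x : ℤ) (ω : Sample) : Bool := ω x (t - 1)

/-! ### The messages -/

/-- The message `M_t(x)`: `M_t(x) = X_t(x) (M_{t-1}(x + 1) + 1)`, with `M_1(x) = X_1(x)`. The value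
`0` at the dummy time `0` encodes this initial condition. -/
def M : ℕ → ℤ → Sample → ℕ
  | 0, _, _ => 0
  | t + 1, x, ω => (X (t + 1) x ω).toNat * (M t (x + 1) ω + 1)

/-- `Z_t(x)`, for `x ≥ 1`: equal to `X_{t+1-x}(x)` if `x ≤ t` and to `0` if `x > t`. -/
def Z (t x : ℕ) (ω : Sample) : Bool := if x ≤ t then X (t + 1 - x) x ω else false

/-- The random vector `(Z_t(1), Z_t(2), …)`. It takes only finitely many values for each `t`. -/
def Zvec (t : ℕ) (ω : Sample) : ℕ → Bool := fun k => Z t (k + 1) ω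

/-- The random vector `(M_{t-1}, …, M_{t-k})`, where `M_t = M_t(1)`; it is used for `k < t`. -/
def past (t k : ℕ) (ω : Sample) : Fin k → ℕ := fun i => M (t - 1 - i) 1 ω

/-! ### Entropy rate and its bounds -/

/-- `H(M_t, …, M_1) / t`. -/
def blockRate (u d : ℝ) (t : ℕ) : ℝ :=
  1 / (t : ℝ) * entropy (netLaw u d) (fun ω (i : Fin t) => M (t - i) 1 ω)

/-- `H(M_t | M_{t-1}, …, M_{t-j+1})`, for `j ≥ 1`. -/
def upperAt (u d : ℝ) (j t : ℕ) : ℝ :=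
  condEntropy (netLaw u d) (M t 1) (past t (j - 1))

/-- `H(M_t | M_{t-1}, …, M_{t-j+1}, (Z_{t-j}(1), Z_{t-j}(2), …))`, for `j ≥ 1`. -/
def lowerAt (u d : ℝ) (j t : ℕ) : ℝ :=
  condEntropy (netLaw u d) (M t 1) (fun ω => (past t (j - 1) ω, Zvec (t - j) ω))

/-- The entropy rate of the process `M = (M_t)`, i.e. `lim_{t → ∞} H(M_t, …, M_1) / t`. -/
def entropyRate (u d : ℝ) : ℝ := limUnder atTop (blockRate u d)

/-- The upper bound `𝓤_j = lim_{t → ∞} H(M_t | M_{t-1}, …, M_{t-j+1})`, for `j ≥ 1`. -/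
def upperBound (u d : ℝ) (j : ℕ) : ℝ := limUnder atTop (upperAt u d j)

/-- The lower bound `𝓛_j = lim_{t → ∞} H(M_t | M_{t-1}, …, M_{t-j+1}, Z_{t-j})`, for `j ≥ 1`. -/
def lowerBound (u d : ℝ) (j : ℕ) : ℝ := limUnder atTop (lowerAt u d j)

end LinearNetwork

end

/-! Read each link in diagonal time: for `t ≥ x`, the states `Z_t(x)` of link `x` form a stationary
two-state chain, independently over `x`. The event `M_t = m` says exactly that `Z_t` is `1` at `1,
…, m` and `0` at `m + 1` (`M_eq_iff`). Joint events of messages and of coordinates of `Z_r` are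
therefore products over the links (`netLaw_atom`), and conditional laws can be compared link by
link.

Bounds. Given `Z_{t-j}` and the messages after time `t - j`, the messages up to time `t - j` are
irrelevant to `M_t` (`slice_markov`). Since conditioning reduces entropy, `H(M_t | M_{t-1}, …, M_1)`
lies between `lowerAt` and `upperAt`.

Gap. For one link, summing over paths compatible with the intermediate observations gives a product
of `2 × 2` matrices. Its determinant is `(1 - u - d) ^ j`, or `0` as soon as one observation fixes
the state (`flow_det`). So the end states are independent up to a relative error of order `|1 - u -
d| ^ j` (`linkLaw_forget`). Only the links `x ≤ M_t + 1` matter for `M_t`. Their expected number is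
at most `1 / (1 - U)`, because `M_t` has geometric tails, and this bounds the loss of entropy
(`truncAt_le_add`).

Limits. If only `K` coordinates of `Z` are kept, the probability of each atom is eventually constant
by stationarity, and the tails allow dominated convergence (`exists_tendsto_truncAt`). The case `K =
0` is the upper bound. The lower bound is a limit in `K`, uniformly in `t`. The entropy of `M_t`
given its whole past is squeezed between the two, hence converges, and the chain rule with Cesàro
averaging identifies its limit as the entropy rate. -/

noncomputable section

namespace LinearNetwork

/-! ### The law of one link -/

section Link

variable {u d : ℝ}

/-- The transition probabilities of a link. -/
def trans (u d : ℝ) (a b : Bool) : ℝ :=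
  if a then (if b then 1 - d else d) else (if b then u else 1 - u)

/-- The stationary law of a link. -/
def stat (u d : ℝ) (b : Bool) : ℝ := if b then u / (u + d) else d / (u + d)

lemma coin_real {q : ℝ} (h0 : 0 ≤ q) (h1 : q ≤ 1) (b : Bool) :
    (coin q).real {b} = if b then q else 1 - q := by
  unfold coin
  rw [bernoulliMeasure_real_apply _ (by measurability)]
  cases b <;> simp [Set.projIcc_of_mem zero_le_one ⟨h0, h1⟩, unitInterval.coe_symm_eq]

lemma step_real (hu : u ∈ Set.Ioo (0 : ℝ) 1) (hd : d ∈ Set.Ioo (0 : ℝ) 1) (a b : Bool) :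
    (step u d a).real {b} = trans u d a b := by
  obtain ⟨h1, h2⟩ := hu
  obtain ⟨h3, h4⟩ := hd
  have : step u d a = coin (if a then 1 - d else u) := rfl
  rw [this, coin_real (by split_ifs <;> linarith) (by split_ifs <;> linarith)]
  cases a <;> cases b <;> simp [trans]

lemma linkLaw_initial (hu : u ∈ Set.Ioo (0 : ℝ) 1) (hd : d ∈ Set.Ioo (0 : ℝ) 1) (b : Bool) :
    (linkLaw u d).real {p | p 0 = b} = stat u d b := by
  obtain ⟨h1, h2⟩ := hu
  obtain ⟨h3, h4⟩ := hd
  have hmap : (linkLaw u d).map (Preorder.frestrictLe (π := fun _ => Bool) 0) =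
      (coin (u / (u + d))).map
        (MeasurableEquiv.piUnique (fun _ : Finset.Iic 0 => Bool)).symm := by
    unfold linkLaw Kernel.trajMeasure
    rw [Measure.map_comp _ _ (by fun_prop), Kernel.traj_map_frestrictLe,
      Kernel.partialTraj_self]
    exact Measure.id_comp
  have hset : {p : ℕ → Bool | p 0 = b} = Preorder.frestrictLe (π := fun _ => Bool) 0 ⁻¹'
      {h : Finset.Iic 0 → Bool | h ⟨0, Finset.mem_Iic.2 le_rfl⟩ = b} := rfl
  have hm : MeasurableSet {h : Finset.Iic 0 → Bool | h ⟨0, Finset.mem_Iic.2 le_rfl⟩ = b} :=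
    (Set.toFinite _).measurableSet
  rw [hset, ← map_measureReal_apply (by fun_prop) hm, hmap,
    map_measureReal_apply (MeasurableEquiv.measurable _) hm]
  have : (MeasurableEquiv.piUnique (fun _ : Finset.Iic 0 => Bool)).symm ⁻¹'
      {h : Finset.Iic 0 → Bool | h ⟨0, Finset.mem_Iic.2 le_rfl⟩ = b} = {b} := by
    ext c
    simp only [Set.mem_preimage, Set.mem_ofPred_eq, Set.mem_singleton_iff]
    rfl
  rw [this, coin_real (by positivity) ((div_le_one (by positivity)).2 (by linarith))]
  cases b
  · simp [stat]; field_simp; ring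
  · simp [stat]

lemma linkLaw_markov (hu : u ∈ Set.Ioo (0 : ℝ) 1) (hd : d ∈ Set.Ioo (0 : ℝ) 1) {n : ℕ}
    {Q : (ℕ → Bool) → Prop} (hQ : DependsOn Q (Set.Iic n)) (a b : Bool) :
    (linkLaw u d).real {p | Q p ∧ p n = a ∧ p (n + 1) = b} =
      (linkLaw u d).real {p | Q p ∧ p n = a} * trans u d a b := by
  -- Padding by `false` turns `Q` into a condition on finite histories; `Q` does not see the
  -- padding.
  set ext : (Finset.Iic n → Bool) → ℕ → Bool :=
    fun h i => if hi : i ∈ Finset.Iic n then h ⟨i, hi⟩ else false with hext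
  set B : Set (Finset.Iic n → Bool) := {h | Q (ext h) ∧ h ⟨n, Finset.mem_Iic.2 le_rfl⟩ = a}
    with hB
  have hQe : ∀ p : ℕ → Bool, Q (ext (Preorder.frestrictLe (π := fun _ => Bool) n p)) = Q p := by
    intro p
    apply hQ
    intro i hi
    have : i ∈ Finset.Iic n := Finset.mem_Iic.2 hi
    simp [hext, Set.mem_Iic.1 hi]
  have hmB : MeasurableSet B := (Set.toFinite _).measurableSet
  have key := Kernel.map_frestrictLe_trajMeasure_compProd_eq_map_trajMeasure
    (X := fun _ => Bool) (μ₀ := coin (u / (u + d)))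
    (κ := fun n => (step u d).comap (fun h : (i : Finset.Iic n) → Bool =>
      h ⟨n, Finset.mem_Iic.2 le_rfl⟩) (measurable_pi_apply _)) (a := n)
  change (linkLaw u d).map (Preorder.frestrictLe (π := fun _ => Bool) n) ⊗ₘ _ =
    (linkLaw u d).map (fun x => (Preorder.frestrictLe (π := fun _ => Bool) n x, x (n + 1))) at key
  have hset1 : {p : ℕ → Bool | Q p ∧ p n = a ∧ p (n + 1) = b} =
      (fun x => (Preorder.frestrictLe (π := fun _ => Bool) n x, x (n + 1))) ⁻¹' (B ×ˢ {b}) := by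
    ext p
    simp only [Set.mem_ofPred_eq, Set.mem_preimage, Set.mem_prod, hB, hQe,
      Set.mem_singleton_iff, and_assoc]
    rfl
  have hset2 : {p : ℕ → Bool | Q p ∧ p n = a} =
      Preorder.frestrictLe (π := fun _ => Bool) n ⁻¹' B := by
    ext p
    simp only [Set.mem_ofPred_eq, Set.mem_preimage, hB, hQe]
    rfl
  have hms : MeasurableSet (B ×ˢ ({b} : Set Bool)) := hmB.prod (by measurability)
  rw [hset1, hset2, ← map_measureReal_apply (by fun_prop) hms,
    ← map_measureReal_apply (by fun_prop) hmB, ← key, measureReal_def, measureReal_def,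
    Measure.compProd_apply_prod hmB (by measurability)]
  have : ∀ h ∈ B, ((step u d).comap (fun h : (i : Finset.Iic n) → Bool =>
      h ⟨n, Finset.mem_Iic.2 le_rfl⟩) (measurable_pi_apply _)) h {b} = step u d a {b} := by
    intro h hh
    rw [Kernel.comap_apply, hh.2]
  rw [setLIntegral_congr_fun hmB this, setLIntegral_const, ENNReal.toReal_mul, mul_comm,
    ← step_real hu hd a b, measureReal_def]

lemma measurableSet_of_dependsOn {n : ℕ} {Q : (ℕ → Bool) → Prop} (hQ : DependsOn Q (Set.Iic n)) :
    MeasurableSet {p | Q p} := by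
  have : {p | Q p} = Preorder.frestrictLe (π := fun _ => Bool) n ⁻¹'
      {h | Q fun i => if hi : i ∈ Finset.Iic n then h ⟨i, hi⟩ else false} := by
    ext p
    simp only [Set.mem_ofPred_eq, Set.mem_preimage]
    rw [iff_iff_eq]
    apply hQ
    intro i hi
    simp [Set.mem_Iic.1 hi]
  rw [this]
  exact (Set.toFinite _).measurableSet.preimage (by fun_prop)

/-! ### Transition weights under constraints -/

/-- `flow u d e b k v` is the probability that a link started from `b` satisfies the constraints
`e 0, …, e (k - 1)` during its first `k` states and is then in state `v`. -/
def flow (u d : ℝ) (e : ℕ → Set Bool) (b : Bool) : ℕ → Bool → ℝ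
  | 0, v => if v = b then 1 else 0
  | k + 1, v => ∑ w : Bool, (e k).indicator (flow u d e b k) w * trans u d w v

lemma linkLaw_flow (hu : u ∈ Set.Ioo (0 : ℝ) 1) (hd : d ∈ Set.Ioo (0 : ℝ) 1) {n : ℕ}
    {Q : (ℕ → Bool) → Prop} (hQ : DependsOn Q (Set.Iic n)) (e : ℕ → Set Bool) (b v : Bool)
    (k : ℕ) :
    (linkLaw u d).real {p | Q p ∧ p n = b ∧ (∀ i < k, p (n + i) ∈ e i) ∧ p (n + k) = v} =
      (linkLaw u d).real {p | Q p ∧ p n = b} * flow u d e b k v := by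
  induction k generalizing v with
  | zero =>
    by_cases h : v = b
    · subst h
      simp [flow]
    · have : {p : ℕ → Bool | Q p ∧ p n = b ∧ (∀ i < 0, p (n + i) ∈ e i) ∧ p (n + 0) = v} = ∅ := by
        ext p
        simp only [Set.mem_ofPred_eq, Set.mem_empty_iff_false, iff_false, add_zero]
        rintro ⟨_, h1, _, h2⟩
        exact h (h2.symm.trans h1)
      rw [this]
      simp [flow, h]
  | succ k ih =>
    -- The constraints up to time `n + k` join the past, and the Markov property is applied at `n +
    -- k`.
    have hdep : DependsOn (fun p : ℕ → Bool => Q p ∧ p n = b ∧ ∀ i < k + 1, p (n + i) ∈ e i)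
        (Set.Iic (n + k)) := by
      intro p q hpq
      have h1 : Q p = Q q := hQ fun i hi => hpq i (by simp at hi ⊢; omega)
      have h2 : p n = q n := hpq n (by simp)
      have h3 : (∀ i < k + 1, p (n + i) ∈ e i) ↔ ∀ i < k + 1, q (n + i) ∈ e i := by
        refine forall₂_congr fun i hi => ?_
        rw [hpq (n + i) (by simp; omega)]
      simp only [h1, h2, h3]
    have hsplit : {p : ℕ → Bool | Q p ∧ p n = b ∧ (∀ i < k + 1, p (n + i) ∈ e i) ∧
        p (n + (k + 1)) = v} = ⋃ w ∈ (Finset.univ : Finset Bool),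
        {p | (Q p ∧ p n = b ∧ ∀ i < k + 1, p (n + i) ∈ e i) ∧ p (n + k) = w ∧
          p (n + k + 1) = v} := by
      ext p
      simp [← add_assoc, and_assoc]
    have hms : ∀ w, MeasurableSet {p : ℕ → Bool | (Q p ∧ p n = b ∧ ∀ i < k + 1, p (n + i) ∈ e i) ∧
        p (n + k) = w ∧ p (n + k + 1) = v} := by
      intro w
      refine measurableSet_of_dependsOn (n := n + k + 1) fun p q hpq => ?_
      have h1 := hdep fun i hi => hpq i (Set.mem_Iic.2 ((Set.mem_Iic.1 hi).trans (Nat.le_succ _)))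
      rw [hpq (n + k) (by simp), hpq (n + k + 1) (by simp)]
      simp only at h1
      rw [h1]
    rw [hsplit, measureReal_biUnion_finset ?_ fun w _ => hms w]
    · simp_rw [linkLaw_markov hu hd hdep, flow, Finset.mul_sum]
      refine Finset.sum_congr rfl fun w _ => ?_
      rw [← mul_assoc]
      congr 1
      by_cases hw : w ∈ e k
      · rw [Set.indicator_of_mem hw, ← ih]
        congr 1
        ext p
        simp only [Set.mem_ofPred_eq, Nat.lt_succ_iff_lt_or_eq, or_imp, forall_and, forall_eq,
          and_assoc]
        refine and_congr_right fun _ => and_congr_right fun _ => and_congr_right fun _ => ?_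
        constructor
        · exact fun h => h.2
        · exact fun h => ⟨h ▸ hw, h⟩
      · rw [Set.indicator_of_notMem hw, mul_zero]
        convert measureReal_empty
        ext p
        simp only [Set.mem_ofPred_eq, Set.mem_empty_iff_false, iff_false]
        rintro ⟨⟨_, _, h⟩, rfl⟩
        exact hw (h k (Nat.lt_succ_self k))
    · intro w _ w' _ hww
      refine Set.disjoint_left.2 fun p hp hp' => hww ?_
      exact hp.2.1.symm.trans hp'.2.1

lemma linkLaw_stat (hu : u ∈ Set.Ioo (0 : ℝ) 1) (hd : d ∈ Set.Ioo (0 : ℝ) 1) (n : ℕ) (b : Bool) :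
    (linkLaw u d).real {p | p n = b} = stat u d b := by
  have hud : u + d ≠ 0 := by linarith [hu.1, hd.1]
  induction n generalizing b with
  | zero => exact linkLaw_initial hu hd b
  | succ n ih =>
    have h := fun a => linkLaw_markov hu hd (n := n) (Q := fun _ => True) (fun _ _ _ => rfl) a b
    simp only [true_and, ih] at h
    have hsplit : {p : ℕ → Bool | p (n + 1) = b} = ⋃ w ∈ (Finset.univ : Finset Bool),
        {p | p n = w ∧ p (n + 1) = b} := by
      ext p
      simp
    rw [hsplit, measureReal_biUnion_finset]
    · simp_rw [h]
      cases b <;> simp [stat, trans] <;> field_simp <;> ring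
    · intro w _ w' _ hww
      exact Set.disjoint_left.2 fun p hp hp' => hww (hp.1.symm.trans hp'.1)
    · intro w _
      refine measurableSet_of_dependsOn (n := n + 1) fun p q hpq => ?_
      rw [hpq n (by simp), hpq (n + 1) (by simp)]

/-- The matrix of `flow` is a product of diagonal `0`-`1` matrices and copies of the transition
matrix, whose determinant is `1 - u - d`. A constraint that excludes a state makes its diagonal
factor singular. -/
lemma flow_det (e : ℕ → Set Bool) (k : ℕ) :
    flow u d e true k true * flow u d e false k false -
        flow u d e true k false * flow u d e false k true =
      (1 - u - d) ^ k *
        ∏ i ∈ Finset.range k, (e i).indicator 1 true * (e i).indicator 1 false := by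
  induction k with
  | zero => simp [flow]
  | succ k ih =>
    rw [Finset.prod_range_succ, pow_succ]
    trans (flow u d e true k true * flow u d e false k false -
        flow u d e true k false * flow u d e false k true) * (1 - u - d) *
        ((e k).indicator 1 true * (e k).indicator 1 false)
    · by_cases h1 : true ∈ e k <;> by_cases h2 : false ∈ e k <;>
        simp [flow, trans, h1, h2] <;> ring
    · rw [ih]; ring

lemma stat_pos (hu : u ∈ Set.Ioo (0 : ℝ) 1) (hd : d ∈ Set.Ioo (0 : ℝ) 1) (b : Bool) :
    0 < stat u d b := by
  have := hu.1
  have := hd.1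
  cases b <;> simp only [stat] <;> simp <;> positivity

lemma stat_add (hu : u ∈ Set.Ioo (0 : ℝ) 1) (hd : d ∈ Set.Ioo (0 : ℝ) 1) :
    stat u d true + stat u d false = 1 := by
  have : u + d ≠ 0 := by linarith [hu.1, hd.1]
  simp [stat]
  field_simp

/-! ### Bridges: loss of memory, Markov property and stationarity of one link -/

/-- The constraints `e` from time `1` on, without a constraint at time `0`. -/
def freeStart (e : ℕ → Set Bool) (i : ℕ) : Set Bool := if i = 0 then Set.univ else e i

lemma freeStart_forall {e : ℕ → Set Bool} {k n : ℕ} {p : ℕ → Bool} :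
    (∀ i < k, p (n + i) ∈ freeStart e i) ↔ ∀ i, 0 < i → i < k → p (n + i) ∈ e i := by
  refine forall_congr' fun i => ?_
  rcases Nat.eq_zero_or_pos i with rfl | hi
  · simp [freeStart]
  · simp [freeStart, hi, hi.ne']

lemma linkLaw_bridge (hu : u ∈ Set.Ioo (0 : ℝ) 1) (hd : d ∈ Set.Ioo (0 : ℝ) 1) {n : ℕ}
    {Q : (ℕ → Bool) → Prop} (hQ : DependsOn Q (Set.Iic n)) (e : ℕ → Set Bool) (b v : Bool)
    (k : ℕ) :
    (linkLaw u d).real {p | Q p ∧ p n = b ∧ (∀ i, 0 < i → i < k → p (n + i) ∈ e i) ∧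
      p (n + k) = v} =
      (linkLaw u d).real {p | Q p ∧ p n = b} * flow u d (freeStart e) b k v := by
  simp_rw [← linkLaw_flow hu hd hQ, freeStart_forall]

lemma dependsOn_bridge (n k : ℕ) (e : ℕ → Set Bool) :
    DependsOn (fun p : ℕ → Bool => ∀ i, 0 < i → i < k → p (n + i) ∈ e i) (Set.Iic (n + k)) := by
  intro p q hpq
  refine propext (forall₃_congr fun i _ hi => ?_)
  rw [hpq (n + i) (by simp; omega)]

lemma dependsOn_eval {n m : ℕ} (h : n ≤ m) (b : Bool) :
    DependsOn (fun p : ℕ → Bool => p n = b) (Set.Iic m) := by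
  intro p q hpq
  simp only [hpq n (Set.mem_Iic.2 h)]

lemma dependsOn_and {n : ℕ} {Q R : (ℕ → Bool) → Prop} (hQ : DependsOn Q (Set.Iic n))
    (hR : DependsOn R (Set.Iic n)) : DependsOn (fun p => Q p ∧ R p) (Set.Iic n) := by
  intro p q hpq
  simp only [hQ hpq, hR hpq]

lemma dependsOn_mono {n m : ℕ} (h : n ≤ m) {Q : (ℕ → Bool) → Prop}
    (hQ : DependsOn Q (Set.Iic n)) : DependsOn Q (Set.Iic m) :=
  fun _ _ hpq => hQ fun i hi => hpq i (Set.mem_Iic.2 ((Set.mem_Iic.1 hi).trans h))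

lemma linkLaw_split {n m : ℕ} {Q : (ℕ → Bool) → Prop} (hQ : DependsOn Q (Set.Iic n)) (hm : m ≤ n) :
    (linkLaw u d).real {p | Q p} = (linkLaw u d).real {p | Q p ∧ p m = true} +
      (linkLaw u d).real {p | Q p ∧ p m = false} := by
  rw [← measureReal_union]
  · congr 1
    ext p
    cases h : p m <;> simp [h]
  · exact Set.disjoint_left.2 fun p hp hp' => by simp_all
  · exact measurableSet_of_dependsOn (dependsOn_and hQ (dependsOn_eval hm _))

/-- Before a link is observed, its state has almost forgotten the initial state; once it is
observed, it has forgotten it completely. -/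
lemma linkLaw_forget (hu : u ∈ Set.Ioo (0 : ℝ) 1) (hd : d ∈ Set.Ioo (0 : ℝ) 1) (n : ℕ) {k : ℕ}
    (e : ℕ → Set Bool) (b v : Bool) :
    (linkLaw u d).real {p | p n = b ∧ (∀ i, 0 < i → i < k → p (n + i) ∈ e i) ∧ p (n + k) = v} *
        (linkLaw u d).real {p | ∀ i, 0 < i → i < k → p (n + i) ∈ e i} ≤
      (1 + (stat u d true * stat u d false)⁻¹ * |1 - u - d| ^ k) *
        ((linkLaw u d).real {p | p n = b ∧ (∀ i, 0 < i → i < k → p (n + i) ∈ e i)} *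
        (linkLaw u d).real {p | (∀ i, 0 < i → i < k → p (n + i) ∈ e i) ∧ p (n + k) = v}) := by
  set μ := linkLaw u d
  set A : (ℕ → Bool) → Prop := fun p => ∀ i, 0 < i → i < k → p (n + i) ∈ e i with hA
  set F : Bool → Bool → ℝ := fun b v => μ.real {p | p n = b ∧ A p ∧ p (n + k) = v} with hF
  have hAd : DependsOn A (Set.Iic (n + k)) := dependsOn_bridge n k e
  have hFf : ∀ b v, F b v = stat u d b * flow u d (freeStart e) b k v := by
    intro b v
    have h := linkLaw_bridge hu hd (n := n) (Q := fun _ => True) (fun _ _ _ => rfl) e b v k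
    simp only [true_and, linkLaw_stat hu hd] at h
    exact h
  have hrow : ∀ b, μ.real {p | p n = b ∧ A p} = F b true + F b false := by
    intro b
    rw [linkLaw_split (dependsOn_and (dependsOn_eval (Nat.le_add_right n k) b) hAd) le_rfl]
    simp only [and_assoc]; rfl
  have hcol : ∀ v, μ.real {p | A p ∧ p (n + k) = v} = F true v + F false v := by
    intro v
    rw [linkLaw_split (dependsOn_and hAd (dependsOn_eval le_rfl v)) (Nat.le_add_right n k)]
    simp only [hF]
    refine congrArg₂ (· + ·) (congrArg _ (Set.ext fun p => ?_))
      (congrArg _ (Set.ext fun p => ?_)) <;> (simp only [Set.mem_ofPred_eq]; tauto)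
  have htot : μ.real {p | A p} = F true true + F true false + (F false true + F false false) := by
    rw [← hrow, ← hrow, linkLaw_split hAd (Nat.le_add_right n k)]
    simp only [and_comm]; rfl
  have hdet := flow_det (u := u) (d := d) (freeStart e) k
  set I : ℝ := ∏ i ∈ Finset.range k,
    (freeStart e i).indicator 1 true * (freeStart e i).indicator 1 false with hI
  -- For a `2 × 2` table, entry times total minus row sum times column sum is plus or minus the
  -- determinant.
  have hle : F b v * μ.real {p | A p} ≤
      μ.real {p | p n = b ∧ A p} * μ.real {p | A p ∧ p (n + k) = v} +
      stat u d true * stat u d false * (|1 - u - d| ^ k * I) := by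
    have hI0 : 0 ≤ I := Finset.prod_nonneg fun i _ =>
      mul_nonneg (Set.indicator_nonneg (by simp) _) (Set.indicator_nonneg (by simp) _)
    have habs := abs_le.1 (le_of_eq (abs_mul ((1 - u - d) ^ k) I))
    rw [abs_of_nonneg hI0, abs_pow, ← hdet] at habs
    have hs : 0 ≤ stat u d true * stat u d false :=
      (mul_pos (stat_pos hu hd _) (stat_pos hu hd _)).le
    have h1 := mul_le_mul_of_nonneg_left habs.1 hs
    have h2 := mul_le_mul_of_nonneg_left habs.2 hs
    rw [htot, hrow, hcol]
    simp only [hFf]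
    cases b <;> cases v <;> nlinarith
  have hnn : 0 ≤ μ.real {p | p n = b ∧ A p} * μ.real {p | A p ∧ p (n + k) = v} := by positivity
  have hs : 0 < stat u d true * stat u d false := mul_pos (stat_pos hu hd _) (stat_pos hu hd _)
  refine hle.trans ?_
  rw [add_mul, one_mul]
  refine add_le_add le_rfl ?_
  -- Without a genuine constraint both marginals are stationary, so their product is at least `stat
  -- u d true * stat u d false`, and the additive error becomes a relative one. With one, the
  -- determinant is zero.
  by_cases hall : ∀ i < k, freeStart e i = Set.univ
  · have hI1 : I = 1 := Finset.prod_eq_one fun i hi => by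
      simp [hall i (Finset.mem_range.1 hi)]
    have hAt : ∀ p, A p := fun p => freeStart_forall.1 fun i hi => by simp [hall i hi]
    have e1 : μ.real {p | p n = b ∧ A p} = stat u d b := by
      simp only [hAt, and_true]; exact linkLaw_stat hu hd n b
    have e2 : μ.real {p | A p ∧ p (n + k) = v} = stat u d v := by
      simp only [hAt, true_and]; exact linkLaw_stat hu hd _ v
    rw [e1, e2, hI1, mul_one, mul_comm (stat u d true * stat u d false) (|1 - u - d| ^ k),
      mul_comm (_⁻¹) (|1 - u - d| ^ k), mul_assoc (|1 - u - d| ^ k)]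
    have hr : 0 ≤ |1 - u - d| ^ k := by positivity
    refine mul_le_mul_of_nonneg_left ?_ hr
    rw [inv_mul_eq_div, le_div_iff₀ hs]
    have hsum := stat_add hu hd
    have hp := stat_pos hu hd true
    have hq := stat_pos hu hd false
    have key : ∀ b, stat u d true * stat u d false ≤ stat u d b := by
      intro b; cases b <;> nlinarith
    exact mul_le_mul (key b) (key v) hs.le (stat_pos hu hd b).le
  · push Not at hall
    obtain ⟨i, hi, hne⟩ := hall
    have hI0 : I = 0 := by
      refine Finset.prod_eq_zero (Finset.mem_range.2 hi) ?_
      by_contra hmul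
      refine hne (Set.eq_univ_of_forall fun w => ?_)
      have h1 := left_ne_zero_of_mul hmul
      have h2 := right_ne_zero_of_mul hmul
      cases w
      · exact Set.mem_of_indicator_ne_zero h2
      · exact Set.mem_of_indicator_ne_zero h1
    rw [hI0, mul_zero, mul_zero]
    positivity

/-- The Markov property: given the state at time `n`, the past and the future are independent. -/
lemma linkLaw_condIndep (hu : u ∈ Set.Ioo (0 : ℝ) 1) (hd : d ∈ Set.Ioo (0 : ℝ) 1) {n k : ℕ}
    {Q : (ℕ → Bool) → Prop} (hQ : DependsOn Q (Set.Iic n)) (e : ℕ → Set Bool) (b v : Bool) :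
    (linkLaw u d).real {p | Q p ∧ p n = b ∧ (∀ i, 0 < i → i < k → p (n + i) ∈ e i) ∧
        p (n + k) = v} *
      (linkLaw u d).real {p | p n = b ∧ (∀ i, 0 < i → i < k → p (n + i) ∈ e i)} =
    (linkLaw u d).real {p | p n = b ∧ (∀ i, 0 < i → i < k → p (n + i) ∈ e i) ∧ p (n + k) = v} *
      (linkLaw u d).real {p | Q p ∧ p n = b ∧ (∀ i, 0 < i → i < k → p (n + i) ∈ e i)} := by
  have hT : DependsOn (fun _ : ℕ → Bool => True) (Set.Iic n) := fun _ _ _ => rfl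
  have h0 := fun v => linkLaw_bridge hu hd hT e b v k
  simp only [true_and] at h0
  have h1 := dependsOn_and (dependsOn_eval (Nat.le_add_right n k) b) (dependsOn_bridge n k e)
  have h2 := dependsOn_and (dependsOn_mono (Nat.le_add_right n k) hQ) h1
  rw [linkLaw_split h1 le_rfl, linkLaw_split h2 le_rfl]
  simp only [and_assoc, linkLaw_bridge hu hd hQ, h0]
  ring

/-- Splitting by the first and the last state expresses the probability through `stat` and `flow`,
neither of which involves the starting time. -/
lemma linkLaw_stationary (hu : u ∈ Set.Ioo (0 : ℝ) 1) (hd : d ∈ Set.Ioo (0 : ℝ) 1) (n m k : ℕ)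
    (e : ℕ → Set Bool) :
    (linkLaw u d).real {p | ∀ i < k, p (n + i) ∈ e i} =
      (linkLaw u d).real {p | ∀ i < k, p (m + i) ∈ e i} := by
  have h : ∀ n, (linkLaw u d).real {p | ∀ i < k, p (n + i) ∈ e i} =
      ∑ b : Bool, ∑ v : Bool, stat u d b * flow u d e b k v := by
    intro n
    have hT : DependsOn (fun _ : ℕ → Bool => True) (Set.Iic n) := fun _ _ _ => rfl
    have h0 := fun b v => linkLaw_flow hu hd hT e b v k
    simp only [true_and, linkLaw_stat hu hd] at h0
    have hA : DependsOn (fun p : ℕ → Bool => ∀ i < k, p (n + i) ∈ e i) (Set.Iic (n + k)) := by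
      intro p q hpq
      refine propext (forall₂_congr fun i hi => ?_)
      rw [hpq (n + i) (by simp; omega)]
    have hAb := fun b => dependsOn_and (dependsOn_eval (Nat.le_add_right n k) b) hA
    rw [linkLaw_split hA (Nat.le_add_right n k)]
    simp only [and_comm (b := _ = true), and_comm (b := _ = false)]
    rw [linkLaw_split (hAb true) le_rfl, linkLaw_split (hAb false) le_rfl]
    simp only [and_assoc, h0, Fintype.sum_bool]
  rw [h, h]

end Link


/-! ### Entropy of random variables with finitely many values -/

section FiniteValued

variable {Ω : Type*} [MeasurableSpace Ω] {P : Measure Ω} {S T R : Type*}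
  {X : Ω → S} {Y : Ω → T} {Z : Ω → R}

/-- A random variable with finitely many values, without a reference to a `σ`-algebra on the
target. -/
def FiniteValued (X : Ω → S) : Prop :=
  (Set.range X).Finite ∧ ∀ s, MeasurableSet {ω | X ω = s}

lemma FiniteValued.prodMk (hX : FiniteValued X) (hY : FiniteValued Y) :
    FiniteValued fun ω => (X ω, Y ω) := by
  refine ⟨(hX.1.prod hY.1).subset ?_, fun s => ?_⟩
  · rintro _ ⟨ω, rfl⟩
    exact ⟨⟨ω, rfl⟩, ⟨ω, rfl⟩⟩
  · simp only [Prod.ext_iff]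
    exact (hX.2 s.1).inter (hY.2 s.2)

lemma FiniteValued.pi {n : ℕ} {X : Fin n → Ω → S} (hX : ∀ i, FiniteValued (X i)) :
    FiniteValued fun ω i => X i ω := by
  refine ⟨(Set.Finite.pi' fun i => (hX i).1).subset ?_, fun s => ?_⟩
  · rintro _ ⟨ω, rfl⟩ i
    exact ⟨ω, rfl⟩
  · have : {ω | (fun i => X i ω) = s} = ⋂ i, {ω | X i ω = s i} := by
      ext ω
      simp [funext_iff]
    rw [this]
    exact MeasurableSet.iInter fun i => (hX i).2 _

lemma FiniteValued.eq_sum_indicator (hX : FiniteValued X) (g : S → ℝ) (ω : Ω) :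
    g (X ω) = ∑ s ∈ hX.1.toFinset, {ω | X ω = s}.indicator (fun _ => g s) ω := by
  classical
  rw [Finset.sum_eq_single (X ω)]
  · exact (Set.indicator_of_mem (Set.mem_ofPred.2 rfl) _).symm
  · intro s _ hs
    exact Set.indicator_of_notMem (fun h => hs (Eq.symm h)) _
  · intro h
    exact absurd (hX.1.mem_toFinset.2 ⟨ω, rfl⟩) h

lemma FiniteValued.integrable [IsFiniteMeasure P] (hX : FiniteValued X) (g : S → ℝ) :
    Integrable (fun ω => g (X ω)) P := by
  simp_rw [hX.eq_sum_indicator g]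
  exact integrable_finsetSum _ fun s _ => (integrable_const _).indicator (hX.2 s)

lemma FiniteValued.integral_eq_sum [IsFiniteMeasure P] (hX : FiniteValued X) (g : S → ℝ) :
    ∫ ω, g (X ω) ∂P = ∑ s ∈ hX.1.toFinset, P.real {ω | X ω = s} * g s := by
  simp_rw [hX.eq_sum_indicator g]
  rw [integral_finsetSum _ fun s _ => (integrable_const _).indicator (hX.2 s)]
  refine Finset.sum_congr rfl fun s _ => ?_
  rw [integral_indicator_const _ (hX.2 s), smul_eq_mul]

lemma FiniteValued.measure_eq_zero (hX : FiniteValued X) {s : S} (hs : s ∉ hX.1.toFinset) :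
    {ω | X ω = s} = ∅ := by
  ext ω
  simp only [Set.mem_ofPred_eq, Set.mem_empty_iff_false, iff_false]
  rintro rfl
  exact hs (hX.1.mem_toFinset.2 ⟨ω, rfl⟩)

lemma FiniteValued.integral_eq_tsum [IsFiniteMeasure P] (hX : FiniteValued X) (g : S → ℝ) :
    ∫ ω, g (X ω) ∂P = ∑' s, P.real {ω | X ω = s} * g s := by
  rw [hX.integral_eq_sum, tsum_eq_sum]
  intro s hs
  rw [hX.measure_eq_zero hs, measureReal_empty, zero_mul]

/-- Entropy as mean information: inequalities between entropies reduce to almost sure inequalities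
between probabilities of atoms. -/
lemma entropy_eq_integral [IsFiniteMeasure P] (hX : FiniteValued X) :
    entropy P X = ∫ ω, - Real.log (P.real {ω' | X ω' = X ω}) ∂P := by
  rw [integral_neg, entropy, hX.integral_eq_tsum fun s => Real.log (P.real {ω' | X ω' = s})]

lemma condEntropy_eq_integral [IsFiniteMeasure P] (hX : FiniteValued X) (hY : FiniteValued Y) :
    condEntropy P X Y = ∫ ω, - Real.log (P.real {ω' | X ω' = X ω ∧ Y ω' = Y ω} /
      P.real {ω' | Y ω' = Y ω}) ∂P := by
  rw [integral_neg, condEntropy, (hX.prodMk hY).integral_eq_tsum fun s : S × T =>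
    Real.log (P.real {ω' | X ω' = s.1 ∧ Y ω' = s.2} / P.real {ω' | Y ω' = s.2})]
  simp only [Prod.ext_iff]

lemma FiniteValued.integrable_log [IsFiniteMeasure P] (hX : FiniteValued X) :
    Integrable (fun ω => - Real.log (P.real {ω' | X ω' = X ω})) P :=
  hX.integrable fun s => - Real.log (P.real {ω' | X ω' = s})

lemma FiniteValued.integrable_log_cond [IsFiniteMeasure P] (hX : FiniteValued X)
    (hY : FiniteValued Y) :
    Integrable (fun ω => - Real.log (P.real {ω' | X ω' = X ω ∧ Y ω' = Y ω} /
      P.real {ω' | Y ω' = Y ω})) P :=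
  (hX.prodMk hY).integrable fun s : S × T =>
    - Real.log (P.real {ω' | X ω' = s.1 ∧ Y ω' = s.2} / P.real {ω' | Y ω' = s.2})

lemma FiniteValued.ae_pos [IsFiniteMeasure P] (hX : FiniteValued X) :
    ∀ᵐ ω ∂P, 0 < P.real {ω' | X ω' = X ω} := by
  have h : ∀ s ∈ hX.1.toFinset, ∀ᵐ ω ∂P, X ω = s → 0 < P.real {ω' | X ω' = s} := by
    intro s _
    by_cases h0 : P.real {ω' | X ω' = s} = 0
    · have h1 : P {ω' | X ω' = s} = 0 := (measureReal_eq_zero_iff).1 h0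
      filter_upwards [measure_eq_zero_iff_ae_notMem.1 h1] with ω hω hs
      exact absurd hs hω
    · exact Eventually.of_forall fun ω _ => lt_of_le_of_ne measureReal_nonneg (Ne.symm h0)
  filter_upwards [(Finset.eventually_all _).2 h] with ω hω
  exact hω _ (hX.1.mem_toFinset.2 ⟨ω, rfl⟩) rfl

lemma FiniteValued.sum_measure_and [IsFiniteMeasure P] (hX : FiniteValued X) {A : Set Ω}
    (hA : MeasurableSet A) :
    ∑ s ∈ hX.1.toFinset, P.real {ω | X ω = s ∧ ω ∈ A} = P.real A := by
  rw [← measureReal_biUnion_finset]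
  · congr 1
    ext ω
    simp
  · intro s _ s' _ hs
    exact Set.disjoint_left.2 fun ω h h' => hs (h.1.symm.trans h'.1)
  · exact fun s _ => (hX.2 s).inter hA

/-- Conditional entropy depends on the condition only through its level sets, so equivalent
encodings are interchangeable. -/
lemma condEntropy_congr [IsFiniteMeasure P] (hX : FiniteValued X) (hY : FiniteValued Y)
    (hZ : FiniteValued Z) (h : ∀ ω ω', Y ω' = Y ω ↔ Z ω' = Z ω) :
    condEntropy P X Y = condEntropy P X Z := by
  rw [condEntropy_eq_integral hX hY, condEntropy_eq_integral hX hZ]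
  simp only [h]

lemma entropy_chain [IsFiniteMeasure P] {W : Ω → R} (hW : FiniteValued W) (hX : FiniteValued X)
    (hY : FiniteValued Y) (h : ∀ ω ω', W ω' = W ω ↔ X ω' = X ω ∧ Y ω' = Y ω) :
    entropy P W = entropy P Y + condEntropy P X Y := by
  rw [entropy_eq_integral hW, entropy_eq_integral hY, condEntropy_eq_integral hX hY,
    ← integral_add hY.integrable_log (hX.integrable_log_cond hY)]
  refine integral_congr_ae ?_
  filter_upwards [hW.ae_pos, hY.ae_pos] with ω h1 h2
  simp only [h] at h1 ⊢
  rw [Real.log_div h1.ne' h2.ne']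
  ring

/-- Comparison of the entropies of `X` given `Y` and given `Z` through their densities. -/
lemma condEntropy_le_add_integral [IsFiniteMeasure P] (hX : FiniteValued X) (hY : FiniteValued Y)
    (hZ : FiniteValued Z) {g : Ω → ℝ} (hg : Integrable g P)
    (h : ∀ ω, P.real {ω' | X ω' = X ω ∧ Z ω' = Z ω} * P.real {ω' | Y ω' = Y ω} ≤
      Real.exp (g ω) *
        (P.real {ω' | X ω' = X ω ∧ Y ω' = Y ω} * P.real {ω' | Z ω' = Z ω})) :
    condEntropy P X Y ≤ condEntropy P X Z + ∫ ω, g ω ∂P := by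
  rw [condEntropy_eq_integral hX hY, condEntropy_eq_integral hX hZ,
    ← integral_add (hX.integrable_log_cond hZ) hg]
  refine integral_mono_ae (hX.integrable_log_cond hY)
    ((hX.integrable_log_cond hZ).add hg) ?_
  filter_upwards [hY.ae_pos, hZ.ae_pos, (hX.prodMk hY).ae_pos, (hX.prodMk hZ).ae_pos] with
    ω h1 h2 h3 h4
  simp only [Prod.mk.injEq] at h3 h4
  have := Real.log_le_log (mul_pos h4 h1) (h ω)
  rw [Real.log_mul h4.ne' h1.ne', Real.log_mul (Real.exp_ne_zero _) (mul_pos h3 h2).ne',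
    Real.log_exp, Real.log_mul h3.ne' h2.ne'] at this
  rw [Real.log_div h3.ne' h1.ne', Real.log_div h4.ne' h2.ne']
  linarith

/-- Conditioning reduces entropy. -/
lemma condEntropy_prodMk_le [IsProbabilityMeasure P] (hX : FiniteValued X) (hY : FiniteValued Y)
    (hZ : FiniteValued Z) :
    condEntropy P X (fun ω => (Y ω, Z ω)) ≤ condEntropy P X Y := by
  have hYZ := hY.prodMk hZ
  have hW := hX.prodMk hYZ
  -- `a` is the law under which `X` and `Z` are independent given `Y`, and `b` is the true law. The
  -- claim is Gibbs' inequality, from `log (a / b) ≤ a / b - 1` and total mass `1` of `a`.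
  set a : S × T × R → ℝ := fun w => P.real {ω | X ω = w.1 ∧ Y ω = w.2.1} *
    P.real {ω | Y ω = w.2.1 ∧ Z ω = w.2.2} / P.real {ω | Y ω = w.2.1} with ha
  set b : S × T × R → ℝ := fun w => P.real {ω | X ω = w.1 ∧ Y ω = w.2.1 ∧ Z ω = w.2.2} with hb
  have ha0 : ∀ w, 0 ≤ a w := fun w => by positivity
  have hint := hW.integrable (P := P) fun w => a w / b w - 1
  have hle : ∫ ω, (a (X ω, Y ω, Z ω) / b (X ω, Y ω, Z ω) - 1) ∂P ≤ 0 := by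
    rw [integral_sub (hW.integrable fun w => a w / b w) (integrable_const _),
      hW.integral_eq_sum fun w => a w / b w]
    simp only [integral_const, probReal_univ, one_smul, sub_nonpos]
    calc ∑ w ∈ hW.1.toFinset, P.real {ω | (X ω, Y ω, Z ω) = w} * (a w / b w)
        ≤ ∑ w ∈ hW.1.toFinset, a w := by
          refine Finset.sum_le_sum fun w _ => ?_
          have : P.real {ω | (X ω, Y ω, Z ω) = w} = b w := by
            simp only [hb, Prod.ext_iff]
          rw [this]
          by_cases h0 : b w = 0
          · rw [h0, zero_mul]; exact ha0 w
          · rw [mul_div_cancel₀ _ h0]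
      _ ≤ ∑ w ∈ hX.1.toFinset ×ˢ hY.1.toFinset ×ˢ hZ.1.toFinset, a w := by
          refine Finset.sum_le_sum_of_subset_of_nonneg ?_ fun w _ _ => ha0 w
          intro w hw
          obtain ⟨ω, rfl⟩ := hW.1.mem_toFinset.1 hw
          simp
      _ = ∑ y ∈ hY.1.toFinset, P.real {ω | Y ω = y} := by
          rw [Finset.sum_product_right, Finset.sum_product]
          refine Finset.sum_congr rfl fun y _ => ?_
          have h1 : ∑ x ∈ hX.1.toFinset, P.real {ω | X ω = x ∧ Y ω = y} = P.real {ω | Y ω = y} :=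
            hX.sum_measure_and (hY.2 y)
          have h2 : ∑ z ∈ hZ.1.toFinset, P.real {ω | Y ω = y ∧ Z ω = z} = P.real {ω | Y ω = y} := by
            simp_rw [and_comm (a := Y _ = y)]
            exact hZ.sum_measure_and (hY.2 y)
          simp only [ha, ← Finset.sum_div, ← Finset.sum_mul, ← Finset.mul_sum, h1, h2]
          rw [mul_self_div_self]
      _ = 1 := by
          have := hY.sum_measure_and (P := P) MeasurableSet.univ
          simpa using this
  refine le_trans ?_ (add_le_of_nonpos_right hle)
  rw [condEntropy_eq_integral hX hY, condEntropy_eq_integral hX hYZ,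
    ← integral_add (hX.integrable_log_cond hY) hint]
  refine integral_mono_ae (hX.integrable_log_cond hYZ)
    ((hX.integrable_log_cond hY).add hint) ?_
  filter_upwards [hY.ae_pos, hYZ.ae_pos, (hX.prodMk hY).ae_pos, hW.ae_pos] with ω h1 h2 h3 h4
  simp only [Prod.mk.injEq] at h2 h3 h4
  simp only [Prod.mk.injEq]
  have hpos : 0 < a (X ω, Y ω, Z ω) := by simp only [ha]; positivity
  have hbpos : 0 < b (X ω, Y ω, Z ω) := h4
  have hlog := Real.log_le_sub_one_of_pos (div_pos hpos hbpos)
  rw [Real.log_div hpos.ne' hbpos.ne'] at hlog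
  simp only [ha] at hlog
  rw [Real.log_div (mul_pos h3 h2).ne' h1.ne', Real.log_mul h3.ne' h2.ne'] at hlog
  rw [Real.log_div h4.ne' h2.ne', Real.log_div h3.ne' h1.ne']
  simp only [ha, hb] at hlog ⊢
  linarith

end FiniteValued


/-! ### Messages as observations of the links -/

section Network

variable {u d : ℝ}

instance : IsProbabilityMeasure (netLaw u d) := by
  unfold netLaw; infer_instance

/-- The states of `Z_t(x)` that are compatible with `M_t = m`. -/
def obs (m x : ℕ) : Set Bool := {b | (x ≤ m → b = true) ∧ (x = m + 1 → b = false)}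

/-- The state `Z_t(x)` as a function of the path of link `x`. -/
def reading (t x : ℕ) (p : ℕ → Bool) : Bool := if x ≤ t then p (t - x) else false

lemma Z_eq_reading (t x : ℕ) (ω : Sample) : Z t x ω = reading t x (ω x) := by
  unfold Z reading X
  split_ifs
  · congr 1
    omega
  · rfl

lemma M_le (t : ℕ) (x : ℤ) (ω : Sample) : M t x ω ≤ t := by
  induction t generalizing x with
  | zero => simp [M]
  | succ t ih =>
    have := ih (x + 1)
    rw [M]
    cases X (t + 1) x ω
    · simp
    · simp; omega

/-- Unrolling the recursion, the message is the length of the run of open states on the diagonal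
going back in time from `(t, x)`. -/
lemma X_of_lt_M {t : ℕ} {x : ℤ} {ω : Sample} {i : ℕ} (h : i < M t x ω) :
    X (t - i) (x + i) ω = true := by
  induction t generalizing x i with
  | zero => simp [M] at h
  | succ t ih =>
    rw [M] at h
    cases hX : X (t + 1) x ω with
    | false => simp [hX] at h
    | true =>
      cases i with
      | zero => simpa using hX
      | succ i =>
        simp only [hX, Bool.toNat_true, one_mul, add_lt_add_iff_right] at h
        have := ih h
        rw [Nat.add_sub_add_right]
        convert this using 1
        push_cast
        ring_nf

lemma X_M_of_lt {t : ℕ} {x : ℤ} {ω : Sample} (h : M t x ω < t) :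
    X (t - M t x ω) (x + M t x ω) ω = false := by
  induction t generalizing x with
  | zero => simp at h
  | succ t ih =>
    rw [M] at h ⊢
    cases hX : X (t + 1) x ω with
    | false => simp [hX]
    | true =>
      simp only [hX, Bool.toNat_true, one_mul, add_lt_add_iff_right, Nat.add_sub_add_right] at h ⊢
      have := ih h
      convert this using 1
      push_cast
      ring_nf

lemma Z_succ_of_lt_M {t : ℕ} {ω : Sample} {i : ℕ} (h : i < M t 1 ω) : Z t (i + 1) ω = true := by
  have h1 := X_of_lt_M h
  have h2 := M_le t 1 ω
  rw [Z, if_pos (by omega), ← h1]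
  congr 1
  · omega
  · push_cast; ring

lemma Z_succ_M (t : ℕ) (ω : Sample) : Z t (M t 1 ω + 1) ω = false := by
  rw [Z]
  split_ifs with h
  · rw [← X_M_of_lt (show M t 1 ω < t by omega)]
    congr 1
    · omega
    · push_cast; ring
  · rfl

lemma Z_mem_obs (t x : ℕ) (hx : 1 ≤ x) (ω : Sample) : Z t x ω ∈ obs (M t 1 ω) x := by
  refine ⟨fun h => ?_, fun h => ?_⟩
  · obtain ⟨i, rfl⟩ := Nat.exists_eq_add_of_le' hx
    exact Z_succ_of_lt_M h
  · rw [h, Z_succ_M]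

/-- Links beyond `m + 1` are unconstrained by `obs m`, so one `N` serves messages of several times
at once. For `m = t`, the terminating `0` is the default value of `Z_t(t + 1)`. -/
lemma M_eq_iff {t m N : ℕ} (hN : m + 1 ≤ N) (ω : Sample) :
    M t 1 ω = m ↔ ∀ x ∈ Finset.Icc 1 N, reading t x (ω x) ∈ obs m x := by
  simp_rw [← Z_eq_reading]
  constructor
  · rintro rfl x hx
    exact Z_mem_obs t x (Finset.mem_Icc.1 hx).1 ω
  · intro h
    rcases lt_trichotomy (M t 1 ω) m with hlt | heq | hgt
    · have h1 := (h (M t 1 ω + 1) (Finset.mem_Icc.2 (by omega))).1 hlt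
      simp [Z_succ_M] at h1
    · exact heq
    · have h1 := (h (m + 1) (Finset.mem_Icc.2 (by omega))).2 rfl
      simp [Z_succ_of_lt_M hgt] at h1

/-! ### Probabilities of observations -/

lemma measurable_reading (t x : ℕ) : Measurable (reading t x) := by
  unfold reading
  split_ifs
  · exact measurable_pi_apply _
  · exact measurable_const

lemma netLaw_box (N : ℕ) {D : ℕ → Set (ℕ → Bool)} (hD : ∀ x, MeasurableSet (D x)) :
    (netLaw u d).real {ω | ∀ x ∈ Finset.Icc 1 N, ω x ∈ D x} =
      ∏ x ∈ Finset.Icc 1 N, (linkLaw u d).real (D x) := by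
  have hset : {ω : Sample | ∀ x ∈ Finset.Icc 1 N, ω x ∈ D x} =
      Set.pi ((Finset.Icc 1 N).map Nat.castEmbedding : Finset ℤ) fun x => D x.toNat := by
    ext ω
    simp only [Set.mem_ofPred_eq, Set.mem_pi, Finset.coe_map, Set.forall_mem_image]
    rfl
  rw [hset, netLaw, measureReal_def, Measure.infinitePi_pi _ fun x _ => hD _,
    ENNReal.toReal_prod, Finset.prod_map]
  rfl

/-- The paths of link `x` that are compatible with `M_s = m s` for `s ∈ I` and, if `x ≤ K`, with
`Z_r(x) = z x`. -/
def slice (m : ℕ → ℕ) (z : ℕ → Bool) (I : Finset ℕ) (K r x : ℕ) : Set (ℕ → Bool) :=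
  {p | (∀ s ∈ I, reading s x p ∈ obs (m s) x) ∧ (x ≤ K → reading r x p = z x)}

lemma measurableSet_slice (m : ℕ → ℕ) (z : ℕ → Bool) (I : Finset ℕ) (K r x : ℕ) :
    MeasurableSet (slice m z I K r x) := by
  have : slice m z I K r x = (⋂ s ∈ I, reading s x ⁻¹' obs (m s) x) ∩
      reading r x ⁻¹' {b | x ≤ K → b = z x} := by
    ext p
    simp [slice]
  rw [this]
  exact (Finset.measurableSet_biInter _ fun s _ =>
    measurable_reading s x (Set.toFinite _).measurableSet).inter
    (measurable_reading r x (Set.toFinite _).measurableSet)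

/-- By `M_eq_iff` the event constrains each link separately, so independence applies. -/
lemma netLaw_atom (m : ℕ → ℕ) (z : ℕ → Bool) (I : Finset ℕ) {K N : ℕ} (r : ℕ)
    (hI : ∀ s ∈ I, m s + 1 ≤ N) (hK : K ≤ N) :
    (netLaw u d).real {ω | (∀ s ∈ I, M s 1 ω = m s) ∧ ∀ x ∈ Finset.Icc 1 K, Z r x ω = z x} =
      ∏ x ∈ Finset.Icc 1 N, (linkLaw u d).real (slice m z I K r x) := by
  rw [← netLaw_box N fun x => measurableSet_slice m z I K r x]
  congr 1
  ext ω
  simp only [Set.mem_ofPred_eq, slice]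
  constructor
  · rintro ⟨h1, h2⟩ x hx
    refine ⟨fun s hs => (M_eq_iff (hI s hs) ω).1 (h1 s hs) x hx, fun hxK => ?_⟩
    rw [← Z_eq_reading]
    exact h2 x (Finset.mem_Icc.2 ⟨(Finset.mem_Icc.1 hx).1, hxK⟩)
  · intro h
    refine ⟨fun s hs => (M_eq_iff (hI s hs) ω).2 fun x hx => (h x hx).1 s hs, fun x hx => ?_⟩
    rw [Z_eq_reading]
    obtain ⟨h1, h2⟩ := Finset.mem_Icc.1 hx
    exact (h x (Finset.mem_Icc.2 ⟨h1, h2.trans hK⟩)).2 h2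

/-- A message of at least `k` needs `k` independent links to be open. This tail controls both the
gap and the dominated convergence. -/
lemma netLaw_le_M (hu : u ∈ Set.Ioo (0 : ℝ) 1) (hd : d ∈ Set.Ioo (0 : ℝ) 1) (t k : ℕ) :
    (netLaw u d).real {ω | k ≤ M t 1 ω} ≤ stat u d true ^ k := by
  calc (netLaw u d).real {ω | k ≤ M t 1 ω}
      ≤ (netLaw u d).real {ω | ∀ x ∈ Finset.Icc 1 k, ω x ∈ {p | reading t x p = true}} := by
        refine measureReal_mono fun ω hω x hx => ?_
        obtain ⟨h1, h2⟩ := Finset.mem_Icc.1 hx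
        have h3 : k ≤ M t 1 ω := hω
        have := (Z_mem_obs t x h1 ω).1 (h2.trans h3)
        rwa [Z_eq_reading] at this
    _ = ∏ x ∈ Finset.Icc 1 k, (linkLaw u d).real {p | reading t x p = true} :=
        netLaw_box k fun x => measurable_reading t x (Set.toFinite {true}).measurableSet
    _ ≤ ∏ x ∈ Finset.Icc 1 k, stat u d true := by
        refine Finset.prod_le_prod (fun _ _ => measureReal_nonneg) fun x _ => ?_
        unfold reading
        split_ifs
        · exact (linkLaw_stat hu hd _ _).le
        · simpa using (stat_pos hu hd true).le
    _ = stat u d true ^ k := by simp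

/-! ### The messages have finitely many values -/

lemma measurable_M (t : ℕ) (x : ℤ) : Measurable (M t x) := by
  induction t generalizing x with
  | zero => exact measurable_const
  | succ t ih =>
    have hX : Measurable (fun ω : Sample => (X (t + 1) x ω).toNat) :=
      (measurable_of_countable Bool.toNat).comp
        ((measurable_pi_apply (t + 1 - 1)).comp (measurable_pi_apply x))
    exact hX.mul ((ih (x + 1)).add_const 1)

lemma finiteValued_M (t : ℕ) (x : ℤ) : FiniteValued (M t x) := by
  refine ⟨(Set.finite_Iic t).subset ?_, fun s => measurable_M t x (measurableSet_singleton s)⟩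
  rintro _ ⟨ω, rfl⟩
  exact M_le t x ω

lemma finiteValued_Z (t x : ℕ) : FiniteValued (Z t x) := by
  refine ⟨Set.toFinite _, fun s => ?_⟩
  have : Z t x = fun ω => reading t x (ω x) := funext fun ω => Z_eq_reading t x ω
  rw [this]
  exact ((measurable_reading t x).comp (measurable_pi_apply _)) (measurableSet_singleton s)

lemma finiteValued_past (t k : ℕ) : FiniteValued (past t k) :=
  FiniteValued.pi fun _ => finiteValued_M _ _

/-- The random vector `(Z_t(1), …, Z_t(K))`. -/
def Zfin (K t : ℕ) (ω : Sample) : Fin K → Bool := fun i => Z t (i + 1) ω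

lemma finiteValued_Zfin (K t : ℕ) : FiniteValued (Zfin K t) :=
  FiniteValued.pi fun _ => finiteValued_Z _ _

lemma Zfin_eq_iff {K t : ℕ} {ω : Sample} {z : ℕ → Bool} :
    (Zfin K t ω = fun i : Fin K => z (i + 1)) ↔ ∀ x ∈ Finset.Icc 1 K, Z t x ω = z x := by
  simp only [funext_iff, Zfin, Finset.mem_Icc]
  constructor
  · rintro h x ⟨h1, h2⟩
    obtain ⟨i, rfl⟩ := Nat.exists_eq_add_of_le' h1
    exact h ⟨i, h2⟩
  · exact fun h i => h _ ⟨by omega, i.2⟩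

lemma Zvec_eq_iff {t : ℕ} {ω ω' : Sample} : Zvec t ω' = Zvec t ω ↔ Zfin t t ω' = Zfin t t ω := by
  constructor
  · intro h
    funext i
    exact congrFun h i
  · intro h
    funext k
    by_cases hk : k < t
    · exact congrFun h ⟨k, hk⟩
    · simp only [Zvec, Z]
      rw [if_neg (by omega), if_neg (by omega)]

lemma finiteValued_Zvec (t : ℕ) : FiniteValued (Zvec t) := by
  refine ⟨?_, fun s => ?_⟩
  · refine ((Set.toFinite (Set.univ : Set (Fin t → Bool))).image
      fun f k => if h : k < t then f ⟨k, h⟩ else false).subset ?_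
    rintro _ ⟨ω, rfl⟩
    refine ⟨Zfin t t ω, trivial, ?_⟩
    funext k
    by_cases hk : k < t
    · simp [hk, Zfin, Zvec]
    · simp only [hk, dif_neg, not_false_eq_true, Zvec, Z]
      rw [if_neg (by omega)]
  · have : {ω | Zvec t ω = s} = ⋂ k, {ω | Z t (k + 1) ω = s k} := by
      ext ω
      simp [funext_iff, Zvec]
    rw [this]
    exact MeasurableSet.iInter fun k => (finiteValued_Z _ _).2 _

lemma past_eq_iff {t k : ℕ} (hk : k ≤ t) {ω : Sample} {m : ℕ → ℕ} :
    (past t k ω = fun i : Fin k => m (t - 1 - i)) ↔ ∀ s ∈ Finset.Ico (t - k) t, M s 1 ω = m s := by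
  simp only [funext_iff, past, Finset.mem_Ico]
  constructor
  · rintro h s ⟨h1, h2⟩
    have := h ⟨t - 1 - s, by omega⟩
    simpa only [show t - 1 - (t - 1 - s) = s by omega] using this
  · exact fun h i => h _ ⟨by omega, by omega⟩

end Network


/-! ### Comparison of the conditional entropies -/

section Compare

variable {u d : ℝ}

/-- The factor that bounds the memory of an unobserved link after `j` steps. -/
def memory (u d : ℝ) (j : ℕ) : ℝ := (stat u d true * stat u d false)⁻¹ * |1 - u - d| ^ j

lemma memory_nonneg (hu : u ∈ Set.Ioo (0 : ℝ) 1) (hd : d ∈ Set.Ioo (0 : ℝ) 1) (j : ℕ) :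
    0 ≤ memory u d j := by
  have := stat_pos hu hd true
  have := stat_pos hu hd false
  unfold memory
  positivity

lemma slice_insert_of_lt {m : ℕ → ℕ} {z : ℕ → Bool} {I : Finset ℕ} {K r x t : ℕ}
    (hx : m t + 1 < x) : slice m z (insert t I) K r x = slice m z I K r x := by
  ext p
  simp only [slice, Set.mem_ofPred_eq, Finset.forall_mem_insert]
  have : reading t x p ∈ obs (m t) x := ⟨fun h => by omega, fun h => by omega⟩
  simp [this]

lemma slice_congr_right {m : ℕ → ℕ} {z : ℕ → Bool} {I : Finset ℕ} {K r x : ℕ}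
    (h : x ≤ K ∨ r < x) (hK : K ≤ r) (hz : r < x → z x = false) :
    slice m z I r r x = slice m z I K r x := by
  ext p
  simp only [slice, Set.mem_ofPred_eq]
  refine and_congr_right fun _ => ?_
  rcases h with h | h
  · simp [h, h.trans hK]
  · have : reading r x p = false := if_neg (by omega)
    simp [this, hz h]

lemma obs_eq_singleton {m x : ℕ} (hx : x ≤ m + 1) : obs m x = {decide (x ≤ m)} := by
  ext b
  simp only [obs, Set.mem_ofPred_eq, Set.mem_singleton_iff]
  by_cases h : x ≤ m
  · simp [h, show x ≠ m + 1 by omega]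
  · simp [show x = m + 1 by omega]

lemma forall_window_iff {m : ℕ → ℕ} {r j x : ℕ} (hx : x ≤ r) {p : ℕ → Bool} :
    (∀ s ∈ Finset.Ioo r (r + j), reading s x p ∈ obs (m s) x) ↔
      ∀ i, 0 < i → i < j → p (r - x + i) ∈ obs (m (r + i)) x := by
  simp only [Finset.mem_Ioo, reading]
  constructor
  · intro h i h0 h1
    have := h (r + i) ⟨by omega, by omega⟩
    rwa [if_pos (by omega), show r + i - x = r - x + i by omega] at this
  · rintro h s ⟨h0, h1⟩
    have := h (s - r) (by omega) (by omega)
    rw [if_pos (by omega)]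
    rwa [show r - x + (s - r) = s - x by omega, show r + (s - r) = s by omega] at this

lemma reading_of_le {t x : ℕ} (hx : x ≤ t) (p : ℕ → Bool) : reading t x p = p (t - x) :=
  if_pos hx

/-- The contribution of one link to the effect of dropping `Z_r(x)` for `x > K`. Nothing is lost if
`x ≤ K`, if `x > r` (the value is a default), or if `M_{r+j}` does not read the link; otherwise
`linkLaw_forget` applies. -/
lemma slice_forget (hu : u ∈ Set.Ioo (0 : ℝ) 1) (hd : d ∈ Set.Ioo (0 : ℝ) 1) {m : ℕ → ℕ}
    {z : ℕ → Bool} {r j K x : ℕ} (hK : K ≤ r) (hz : r < x → z x = false) :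
    (linkLaw u d).real (slice m z (insert (r + j) (Finset.Ioo r (r + j))) r r x) *
        (linkLaw u d).real (slice m z (Finset.Ioo r (r + j)) K r x) ≤
      (if K < x ∧ x ≤ m (r + j) + 1 then 1 + memory u d j else 1) *
      ((linkLaw u d).real (slice m z (Finset.Ioo r (r + j)) r r x) *
        (linkLaw u d).real (slice m z (insert (r + j) (Finset.Ioo r (r + j))) K r x)) := by
  have hκ : (1 : ℝ) ≤ if K < x ∧ x ≤ m (r + j) + 1 then 1 + memory u d j else 1 := by
    have := memory_nonneg hu hd j
    split_ifs <;> linarith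
  by_cases h1 : x ≤ K ∨ r < x
  · rw [slice_congr_right h1 hK hz, slice_congr_right h1 hK hz, mul_comm]
    exact le_mul_of_one_le_left (by positivity) hκ
  by_cases h2 : m (r + j) + 1 < x
  · rw [slice_insert_of_lt h2, slice_insert_of_lt h2]
    exact le_mul_of_one_le_left (by positivity) hκ
  push Not at h1 h2
  obtain ⟨h1, h3⟩ := h1
  rw [if_pos ⟨h1, h2⟩]
  have hfor := linkLaw_forget hu hd (r - x) (k := j) (fun i => obs (m (r + i)) x) (z x)
    (decide (x ≤ m (r + j)))
  have hins : ∀ p, reading (r + j) x p ∈ obs (m (r + j)) x ↔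
      p (r - x + j) = decide (x ≤ m (r + j)) := by
    intro p
    rw [obs_eq_singleton h2, Set.mem_singleton_iff, reading_of_le (by omega),
      show r + j - x = r - x + j by omega]
  have hins' : ∀ I : Finset ℕ, ∀ K, slice m z (insert (r + j) I) K r x =
      {p | p ∈ slice m z I K r x ∧ p (r - x + j) = decide (x ≤ m (r + j))} := by
    intro I K
    ext p
    simp only [slice, Set.mem_ofPred_eq, Finset.forall_mem_insert, hins]
    tauto
  have hr : slice m z (Finset.Ioo r (r + j)) r r x = {p | p (r - x) = z x ∧
      ∀ i, 0 < i → i < j → p (r - x + i) ∈ obs (m (r + i)) x} := by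
    ext p
    simp only [slice, Set.mem_ofPred_eq, forall_window_iff h3, reading_of_le h3, h3, forall_const]
    tauto
  have hK' : slice m z (Finset.Ioo r (r + j)) K r x =
      {p | ∀ i, 0 < i → i < j → p (r - x + i) ∈ obs (m (r + i)) x} := by
    ext p
    simp only [slice, Set.mem_ofPred_eq, forall_window_iff h3, not_le.2 h1, false_imp_iff,
      and_true]
  simp only [hins', hr, hK', memory, Set.mem_ofPred_eq, and_assoc]
  exact hfor

/-- For `x ≤ r` this is the Markov property at coordinate `r - x`. For `x > r` the messages up to
time `r` do not constrain the link, since `m s ≤ s`. -/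
lemma slice_markov (hu : u ∈ Set.Ioo (0 : ℝ) 1) (hd : d ∈ Set.Ioo (0 : ℝ) 1) {m : ℕ → ℕ}
    (hm : ∀ s, m s ≤ s) {z : ℕ → Bool} {r j x : ℕ} (hj : 1 ≤ j) :
    (linkLaw u d).real (slice m z (insert (r + j) (Finset.Ico 1 (r + j))) r r x) *
        (linkLaw u d).real (slice m z (Finset.Ioo r (r + j)) r r x) =
      (linkLaw u d).real (slice m z (insert (r + j) (Finset.Ioo r (r + j))) r r x) *
        (linkLaw u d).real (slice m z (Finset.Ico 1 (r + j)) r r x) := by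
  by_cases h2 : m (r + j) + 1 < x
  · rw [slice_insert_of_lt h2, slice_insert_of_lt h2, mul_comm]
  have hico : ∀ Q : ℕ → Prop, (∀ s ∈ Finset.Ico 1 (r + j), Q s) ↔
      (∀ s ∈ Finset.Icc 1 r, Q s) ∧ ∀ s ∈ Finset.Ioo r (r + j), Q s := by
    intro Q
    simp only [Finset.mem_Ico, Finset.mem_Icc, Finset.mem_Ioo]
    refine ⟨fun h => ⟨fun s hs => h s (by omega), fun s hs => h s (by omega)⟩, fun h s hs => ?_⟩
    rcases le_or_gt s r with h1 | h1
    · exact h.1 s (by omega)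
    · exact h.2 s (by omega)
  have hins : ∀ I : Finset ℕ, slice m z (insert (r + j) I) r r x =
      {p | p ∈ slice m z I r r x ∧ reading (r + j) x p ∈ obs (m (r + j)) x} := by
    intro I
    ext p
    simp only [slice, Set.mem_ofPred_eq, Finset.forall_mem_insert]
    tauto
  have hsl : slice m z (Finset.Ico 1 (r + j)) r r x =
      {p | (∀ s ∈ Finset.Icc 1 r, reading s x p ∈ obs (m s) x) ∧
        p ∈ slice m z (Finset.Ioo r (r + j)) r r x} := by
    ext p
    simp only [slice, Set.mem_ofPred_eq, hico, and_assoc]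
  rcases lt_or_ge r x with h3 | h3
  · have hpast : ∀ p, ∀ s ∈ Finset.Icc 1 r, reading s x p ∈ obs (m s) x := by
      intro p s hs
      have hs' := Finset.mem_Icc.1 hs
      have h4 := hm s
      rw [show reading s x p = false from if_neg (by omega)]
      exact ⟨fun h => by omega, fun _ => rfl⟩
    have : slice m z (Finset.Ico 1 (r + j)) r r x = slice m z (Finset.Ioo r (r + j)) r r x := by
      rw [hsl]
      ext p
      exact and_iff_right (hpast p)
    rw [hins, hins, this]
  have hQ : DependsOn (fun p : ℕ → Bool => ∀ s ∈ Finset.Icc 1 r, reading s x p ∈ obs (m s) x)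
      (Set.Iic (r - x)) := by
    intro p q hpq
    refine propext (forall₂_congr fun s hs => ?_)
    have hs' := Finset.mem_Icc.1 hs
    unfold reading
    split_ifs
    · rw [hpq (s - x) (Set.mem_Iic.2 (by omega))]
    · rfl
  have hci := linkLaw_condIndep hu hd (k := j) hQ (fun i => obs (m (r + i)) x) (z x)
    (decide (x ≤ m (r + j)))
  have hend : ∀ p, reading (r + j) x p ∈ obs (m (r + j)) x ↔
      p (r - x + j) = decide (x ≤ m (r + j)) := by
    intro p
    rw [obs_eq_singleton (not_lt.1 h2), Set.mem_singleton_iff, reading_of_le (by omega),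
      show r + j - x = r - x + j by omega]
  have hr : slice m z (Finset.Ioo r (r + j)) r r x = {p | p (r - x) = z x ∧
      ∀ i, 0 < i → i < j → p (r - x + i) ∈ obs (m (r + i)) x} := by
    ext p
    simp only [slice, Set.mem_ofPred_eq, forall_window_iff h3, reading_of_le h3, h3, forall_const]
    tauto
  simp only [hins, hsl, hr, hend, Set.mem_ofPred_eq, and_assoc]
  exact hci

/-- `H(M_t | M_{t-1}, …, M_{t-j+1}, Z_{t-j}(1), …, Z_{t-j}(K))`. -/
def truncAt (u d : ℝ) (K j t : ℕ) : ℝ :=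
  condEntropy (netLaw u d) (M t 1) fun ω => (past t (j - 1) ω, Zfin K (t - j) ω)

lemma finiteValued_cond (K r k t : ℕ) : FiniteValued fun ω => (past t k ω, Zfin K r ω) :=
  (finiteValued_past t k).prodMk (finiteValued_Zfin K r)

/-- `truncAt` interpolates between the bounds: `K = 0` reveals nothing, and `K = t - j` reveals
every coordinate of `Z_{t-j}` that is not a default. -/
lemma upperAt_eq (j t : ℕ) : upperAt u d j t = truncAt u d 0 j t := by
  refine condEntropy_congr (finiteValued_M t 1) (finiteValued_past _ _)
    (finiteValued_cond _ _ _ _) fun ω ω' => ?_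
  rw [Prod.mk.injEq]
  exact (and_iff_left (Subsingleton.elim _ _)).symm

lemma lowerAt_eq (j t : ℕ) : lowerAt u d j t = truncAt u d (t - j) j t := by
  refine condEntropy_congr (finiteValued_M t 1)
    ((finiteValued_past _ _).prodMk (finiteValued_Zvec _)) (finiteValued_cond _ _ _ _)
    fun ω ω' => ?_
  rw [Prod.mk.injEq, Prod.mk.injEq, Zvec_eq_iff]

lemma netLaw_cond {t k r K N : ℕ} (hk : k ≤ t) (hN : t + 1 ≤ N) (hK : K ≤ N) (ω : Sample) :
    (netLaw u d).real {ω' | (past t k ω', Zfin K r ω') = (past t k ω, Zfin K r ω)} =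
      ∏ x ∈ Finset.Icc 1 N, (linkLaw u d).real
        (slice (fun s => M s 1 ω) (fun x => Z r x ω) (Finset.Ico (t - k) t) K r x) := by
  rw [← netLaw_atom _ _ _ r (fun s hs => ?_) hK]
  · congr 1
    ext ω'
    simp only [Set.mem_ofPred_eq, Prod.mk.injEq]
    rw [← past_eq_iff hk, ← Zfin_eq_iff]
    rfl
  · have := M_le s 1 ω
    have := (Finset.mem_Ico.1 hs).2
    omega

lemma netLaw_joint {t k r K N : ℕ} (hk : k ≤ t) (hN : t + 1 ≤ N) (hK : K ≤ N) (ω : Sample) :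
    (netLaw u d).real {ω' | M t 1 ω' = M t 1 ω ∧
        (past t k ω', Zfin K r ω') = (past t k ω, Zfin K r ω)} =
      ∏ x ∈ Finset.Icc 1 N, (linkLaw u d).real
        (slice (fun s => M s 1 ω) (fun x => Z r x ω) (insert t (Finset.Ico (t - k) t)) K r x) := by
  rw [← netLaw_atom _ _ _ r (fun s hs => ?_) hK]
  · congr 1
    ext ω'
    simp only [Set.mem_ofPred_eq, Prod.mk.injEq, Finset.forall_mem_insert, and_assoc]
    rw [← past_eq_iff hk, ← Zfin_eq_iff]
    rfl
  · have := M_le s 1 ω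
    have : s ≤ t := by
      rcases Finset.mem_insert.1 hs with rfl | hs
      · exact le_rfl
      · exact (Finset.mem_Ico.1 hs).2.le
    omega

lemma Ico_window {r j : ℕ} (hj : 1 ≤ j) :
    Finset.Ico (r + j - (j - 1)) (r + j) = Finset.Ioo r (r + j) := by
  ext s
  simp only [Finset.mem_Ico, Finset.mem_Ioo]
  omega

/-- Once `Z_r` is known, adding the messages up to time `r` to the condition changes nothing;
dropping `Z_r` afterwards only increases the entropy. -/
lemma truncAt_le_upperAt_self (hu : u ∈ Set.Ioo (0 : ℝ) 1) (hd : d ∈ Set.Ioo (0 : ℝ) 1)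
    {r j : ℕ} (hj : 1 ≤ j) : truncAt u d r j (r + j) ≤ upperAt u d (r + j) (r + j) := by
  refine le_trans ?_ (condEntropy_prodMk_le (finiteValued_M _ 1) (finiteValued_past _ _)
    (finiteValued_Zfin r r))
  have h := condEntropy_le_add_integral (P := netLaw u d) (finiteValued_M (r + j) 1)
    (finiteValued_cond r r (j - 1) (r + j)) (finiteValued_cond r r (r + j - 1) (r + j))
    (g := fun _ => 0) (integrable_const _) fun ω => ?_
  · simpa [truncAt] using h
  · rw [netLaw_joint (by omega) le_rfl (by omega), netLaw_joint (by omega) le_rfl (by omega),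
      netLaw_cond (by omega) le_rfl (by omega), netLaw_cond (by omega) le_rfl (by omega),
      Real.exp_zero, one_mul, ← Finset.prod_mul_distrib, ← Finset.prod_mul_distrib,
      Ico_window hj, show r + j - (r + j - 1) = 1 by omega]
    exact (Finset.prod_congr rfl fun x _ =>
      slice_markov hu hd (fun s => M_le s 1 ω) hj).le

lemma upperAt_antitone {j k t : ℕ} (hjk : j ≤ k) :
    upperAt u d k t ≤ upperAt u d j t := by
  have h := condEntropy_prodMk_le (P := netLaw u d) (finiteValued_M t 1)
    (finiteValued_past t (j - 1)) (finiteValued_past t (k - 1))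
  refine le_trans (le_of_eq ?_) h
  refine condEntropy_congr (finiteValued_M t 1) (finiteValued_past _ _)
    ((finiteValued_past _ _).prodMk (finiteValued_past _ _)) fun ω ω' => ?_
  rw [Prod.mk.injEq]
  refine ⟨fun h => ⟨?_, h⟩, fun h => h.2⟩
  funext i
  exact congrFun h ⟨i, by omega⟩

lemma truncAt_antitone (n K j t : ℕ) : truncAt u d (n + K) j t ≤ truncAt u d K j t := by
  have h := condEntropy_prodMk_le (P := netLaw u d) (finiteValued_M t 1)
    (finiteValued_cond K (t - j) (j - 1) t) (finiteValued_Zfin (n + K) (t - j))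
  refine le_trans (le_of_eq ?_) h
  refine condEntropy_congr (finiteValued_M t 1) (finiteValued_cond _ _ _ _)
    ((finiteValued_cond _ _ _ _).prodMk (finiteValued_Zfin _ _)) fun ω ω' => ?_
  simp only [Prod.mk.injEq]
  refine ⟨fun h => ⟨⟨h.1, ?_⟩, h.2⟩, fun h => ⟨h.1.1, h.2⟩⟩
  funext i
  exact congrFun h.2 ⟨i, by omega⟩

lemma stat_lt_one (hu : u ∈ Set.Ioo (0 : ℝ) 1) (hd : d ∈ Set.Ioo (0 : ℝ) 1) (b : Bool) :
    stat u d b < 1 := by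
  have h1 := stat_pos hu hd true
  have h2 := stat_pos hu hd false
  have h3 := stat_add hu hd
  cases b <;> linarith

/-- Each link `x` with `K < x ≤ M_{r+j} + 1` costs at most `memory u d j` in the logarithm of the
conditional probability. The expected number of such links is at most the sum of `U ^ i` over `i ≥
K`. -/
lemma truncAt_le_add (hu : u ∈ Set.Ioo (0 : ℝ) 1) (hd : d ∈ Set.Ioo (0 : ℝ) 1) {r j K : ℕ}
    (hj : 1 ≤ j) (hK : K ≤ r) :
    truncAt u d K j (r + j) ≤ truncAt u d r j (r + j) +
      memory u d j * (stat u d true ^ K / (1 - stat u d true)) := by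
  set U := stat u d true with hU
  have hU0 : 0 < U := stat_pos hu hd true
  have hU1 : U < 1 := stat_lt_one hu hd true
  have hm := memory_nonneg hu hd j
  set N := r + j + 1 with hN
  set g : Sample → ℝ := fun ω => ∑ x ∈ Finset.Icc 1 N,
    if K < x ∧ x ≤ M (r + j) 1 ω + 1 then memory u d j else 0 with hg
  have hgi : Integrable g (netLaw u d) := (finiteValued_M (r + j) 1).integrable fun m =>
    ∑ x ∈ Finset.Icc 1 N, if K < x ∧ x ≤ m + 1 then memory u d j else 0
  have h := condEntropy_le_add_integral (P := netLaw u d) (finiteValued_M (r + j) 1)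
    (finiteValued_cond K r (j - 1) (r + j)) (finiteValued_cond r r (j - 1) (r + j)) hgi
    fun ω => ?_
  · have hr : r + j - j = r := by omega
    rw [truncAt, truncAt, hr]
    refine h.trans (add_le_add le_rfl ?_)
    have hterm : ∀ x, (fun ω => if K < x ∧ x ≤ M (r + j) 1 ω + 1 then memory u d j else 0) =
        {ω : Sample | K < x ∧ x ≤ M (r + j) 1 ω + 1}.indicator fun _ => memory u d j := by
      intro x
      funext ω
      simp [Set.indicator]
    have hms : ∀ x, MeasurableSet {ω : Sample | K < x ∧ x ≤ M (r + j) 1 ω + 1} := by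
      intro x
      exact measurable_M (r + j) 1 (Set.to_countable {m | K < x ∧ x ≤ m + 1}).measurableSet
    rw [integral_finsetSum]
    · calc ∑ x ∈ Finset.Icc 1 N,
            ∫ ω, (if K < x ∧ x ≤ M (r + j) 1 ω + 1 then memory u d j else 0) ∂netLaw u d
          ≤ ∑ x ∈ Finset.Icc 1 N, if K < x then memory u d j * U ^ (x - 1) else 0 := by
            refine Finset.sum_le_sum fun x _ => ?_
            rw [hterm, integral_indicator_const _ (hms x), smul_eq_mul, mul_comm]
            split_ifs with hx
            · refine mul_le_mul_of_nonneg_left ?_ hm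
              refine le_trans (measureReal_mono ?_) (netLaw_le_M hu hd (r + j) (x - 1))
              rintro ω ⟨_, h2⟩
              change x - 1 ≤ M (r + j) 1 ω
              omega
            · simp [hx]
        _ = memory u d j * ∑ i ∈ Finset.Ico K N, U ^ i := by
            rw [← Finset.sum_filter, ← Finset.mul_sum]
            congr 1
            refine Finset.sum_nbij' (fun x => x - 1) (fun i => i + 1) ?_ ?_ ?_ ?_ ?_ <;>
              simp <;> omega
        _ ≤ memory u d j * (U ^ K / (1 - U)) := by
            refine mul_le_mul_of_nonneg_left ?_ hm
            exact geom_sum_Ico_le_of_lt_one hU0.le hU1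
    · intro x _
      rw [hterm]
      exact (integrable_const _).indicator (hms x)
  · rw [netLaw_joint (by omega) le_rfl (by omega), netLaw_joint (by omega) le_rfl (by omega),
      netLaw_cond (by omega) le_rfl (by omega), netLaw_cond (by omega) le_rfl (by omega),
      mul_comm (∏ x ∈ _, (linkLaw u d).real (slice _ _ (insert _ _) K _ _)),
      Real.exp_sum, ← Finset.prod_mul_distrib, ← Finset.prod_mul_distrib,
      ← Finset.prod_mul_distrib, Ico_window hj]
    refine Finset.prod_le_prod (fun _ _ => by positivity) fun x _ => ?_
    refine (slice_forget hu hd hK fun hx => ?_).trans ?_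
    · rw [Z_eq_reading]
      exact if_neg (by omega)
    · refine mul_le_mul_of_nonneg_right ?_ (by positivity)
      split_ifs
      -- `1 + memory` is at most `exp memory`, so the factors of the links multiply to at most `exp
      -- (g ω)`.
      · linarith [Real.add_one_le_exp (memory u d j)]
      · simp

end Compare


/-! ### Existence of the limits -/

section Limits

variable {u d : ℝ}

/-- For `r ≥ N` no link of the box shows a default value, and stationarity moves each window to
coordinate `0`; the right-hand side is free of `r`. -/
lemma netLaw_window (hu : u ∈ Set.Ioo (0 : ℝ) 1) (hd : d ∈ Set.Ioo (0 : ℝ) 1) {v : ℕ → ℕ}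
    {z : ℕ → Bool} {I : Finset ℕ} {j K N r : ℕ} (hI : ∀ i ∈ I, 1 ≤ i ∧ i ≤ j)
    (hv : ∀ i ∈ I, v i + 1 ≤ N) (hK : K ≤ N) (hr : N ≤ r) :
    (netLaw u d).real {ω | (∀ i ∈ I, M (r + i) 1 ω = v i) ∧ ∀ x ∈ Finset.Icc 1 K, Z r x ω = z x} =
      ∏ x ∈ Finset.Icc 1 N, (linkLaw u d).real {p | ∀ i < j + 1, p (0 + i) ∈
        {b | (i ∈ I → b ∈ obs (v i) x) ∧ (i = 0 → x ≤ K → b = z x)}} := by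
  have h := netLaw_atom (u := u) (d := d) (fun s => v (s - r)) z (I.image (r + ·)) (K := K)
    (N := N) r (by simpa using hv) hK
  simp only [Finset.forall_mem_image, Nat.add_sub_cancel_left] at h
  rw [h]
  refine Finset.prod_congr rfl fun x hx => ?_
  have hxr : x ≤ r := (Finset.mem_Icc.1 hx).2.trans hr
  rw [linkLaw_stationary hu hd 0 (r - x)]
  congr 1
  ext p
  simp only [slice, Set.mem_ofPred_eq, Finset.forall_mem_image, Nat.add_sub_cancel_left]
  have hread : ∀ i, reading (r + i) x p = p (r - x + i) := by
    intro i
    rw [reading_of_le (by omega)]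
    congr 1
    omega
  have h0 := hread 0
  simp only [add_zero] at h0
  simp only [hread, h0]
  constructor
  · rintro ⟨h1, h2⟩ i _
    exact ⟨fun hi => h1 hi, fun hi hx => by subst hi; exact h2 hx⟩
  · intro h
    exact ⟨fun i hi => (h i (Nat.lt_succ_of_le (hI i hi).2)).1 hi, fun hx => (h 0 (by omega)).2 rfl hx⟩

/-- The values of the messages in a window, from the present one and the past ones. -/
def windowVal {k : ℕ} (m : ℕ) (a : Fin k → ℕ) (i : ℕ) : ℕ :=
  if i = k + 1 then m else if h : k - i < k then a ⟨k - i, h⟩ else 0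

lemma past_window {r k : ℕ} {m : ℕ} {a : Fin k → ℕ} {ω : Sample} :
    past (r + (k + 1)) k ω = a ↔
      ∀ i ∈ Finset.Icc 1 k, M (r + i) 1 ω = windowVal m a i := by
  simp only [funext_iff, past, Finset.mem_Icc]
  constructor
  · rintro h i ⟨h1, h2⟩
    have := h ⟨k - i, by omega⟩
    rw [windowVal, if_neg (by omega), dif_pos (by omega), ← this]
    congr 1
    simp only
    omega
  · intro h i
    have hi := i.2
    have := h (k - i) ⟨by omega, by omega⟩
    rw [windowVal, if_neg (by omega), dif_pos (by omega)] at this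
    simp only [show k - (k - (i : ℕ)) = i by omega] at this
    rw [← this]
    congr 1
    omega

lemma extend_fin {K : ℕ} (z : Fin K → Bool) :
    z = fun i : Fin K => (fun x : ℕ => if h : x - 1 < K then z ⟨x - 1, h⟩ else false) (i + 1) := by
  funext i
  simp

lemma eventually_const_cond (hu : u ∈ Set.Ioo (0 : ℝ) 1) (hd : d ∈ Set.Ioo (0 : ℝ) 1) (K k : ℕ)
    (w : (Fin k → ℕ) × (Fin K → Bool)) :
    ∃ q : ℝ, ∀ᶠ r in atTop, (netLaw u d).real
      {ω | (past (r + (k + 1)) k ω, Zfin K r ω) = w} = q := by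
  obtain ⟨a, z⟩ := w
  -- The sum is a crude upper bound for the maximum: the box contains every link that is read.
  set N := K + ∑ i ∈ Finset.Icc 1 k, windowVal 0 a i + 1
  have hv : ∀ i ∈ Finset.Icc 1 k, windowVal 0 a i + 1 ≤ N := fun i hi => by
    have := Finset.single_le_sum (f := windowVal 0 a) (fun _ _ => Nat.zero_le _) hi
    omega
  have key := fun r (hr : N ≤ r) => netLaw_window hu hd (K := K)
    (z := fun x : ℕ => if h : x - 1 < K then z ⟨x - 1, h⟩ else false)
    (fun i hi => Finset.mem_Icc.1 hi) hv (by omega) hr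
  refine ⟨_, (eventually_ge_atTop N).mono fun r hr => Eq.trans ?_ (key r hr)⟩
  congr 1
  ext ω
  simp only [Set.mem_ofPred_eq, Prod.mk.injEq, ← past_window, ← Zfin_eq_iff, ← extend_fin]

lemma eventually_const_joint (hu : u ∈ Set.Ioo (0 : ℝ) 1) (hd : d ∈ Set.Ioo (0 : ℝ) 1) (K k : ℕ)
    (w : ℕ × (Fin k → ℕ) × (Fin K → Bool)) :
    ∃ q : ℝ, ∀ᶠ r in atTop, (netLaw u d).real
      {ω | M (r + (k + 1)) 1 ω = w.1 ∧ (past (r + (k + 1)) k ω, Zfin K r ω) = w.2} = q := by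
  obtain ⟨m, a, z⟩ := w
  set I := insert (k + 1) (Finset.Icc 1 k)
  set N := K + ∑ i ∈ I, windowVal m a i + 1
  have hI : ∀ i ∈ I, 1 ≤ i ∧ i ≤ k + 1 := fun i hi => by
    have := Finset.mem_insert.1 hi
    rw [Finset.mem_Icc] at this
    omega
  have hv : ∀ i ∈ I, windowVal m a i + 1 ≤ N := fun i hi => by
    have := Finset.single_le_sum (f := windowVal m a) (fun _ _ => Nat.zero_le _) hi
    omega
  have key := fun r (hr : N ≤ r) => netLaw_window hu hd (K := K)
    (z := fun x : ℕ => if h : x - 1 < K then z ⟨x - 1, h⟩ else false) hI hv (by omega) hr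
  refine ⟨_, (eventually_ge_atTop N).mono fun r hr => Eq.trans ?_ (key r hr)⟩
  congr 1
  ext ω
  simp only [I, Set.mem_ofPred_eq, Prod.mk.injEq, Finset.forall_mem_insert, ← past_window,
    ← Zfin_eq_iff, ← extend_fin, and_assoc]
  simp [windowVal]

/-- From `p ≤ p / q` and `-log √p ≤ 1 / √p - 1`. The bound does not involve `q`, as the domination
needs. -/
lemma abs_mul_log_div_le {p q : ℝ} (hp : 0 ≤ p) (hpq : p ≤ q) (hq : q ≤ 1) :
    |p * Real.log (p / q)| ≤ 2 * √p := by
  rcases hp.eq_or_lt with rfl | hp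
  · simp
  have hq0 : 0 < q := hp.trans_le hpq
  have h1 : p * Real.log (p / q) ≤ 0 := mul_nonpos_of_nonneg_of_nonpos hp.le
    (Real.log_nonpos (by positivity) ((div_le_one hq0).2 hpq))
  have hs : 0 < √p := Real.sqrt_pos.2 hp
  have h2 : Real.log p ≤ Real.log (p / q) :=
    Real.log_le_log hp (by rw [le_div_iff₀ hq0]; nlinarith)
  have h3 := Real.one_sub_inv_le_log_of_pos hs
  rw [Real.log_sqrt hp.le] at h3
  have h4 : p * (√p)⁻¹ = √p := by
    field_simp
    exact (Real.sq_sqrt hp.le).symm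
  rw [abs_of_nonpos h1]
  nlinarith [mul_le_mul_of_nonneg_left h2 hp.le, mul_le_mul_of_nonneg_left h3 hp.le]

lemma summable_prod_pow {ρ : ℝ} (h0 : 0 ≤ ρ) (h1 : ρ < 1) (k : ℕ) :
    Summable fun a : Fin k → ℕ => ∏ i, ρ ^ a i := by
  induction k with
  | zero => exact (hasSum_fintype _).summable
  | succ k ih =>
    rw [← (Fin.consEquiv fun _ : Fin (k + 1) => ℕ).summable_iff]
    have := (summable_geometric_of_lt_one h0 h1).mul_of_nonneg ih (fun _ => by positivity)
      fun _ => by dsimp only; positivity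
    refine this.congr fun x => ?_
    simp [Fin.consEquiv, Fin.prod_univ_succ]

/-- Multiplying the `k + 1` tail bounds and taking a root of order `2 * (k + 1)` gives a bound that
is summable over all values jointly. -/
lemma sqrt_le_of_pow_bounds {U ρ p : ℝ} {k m : ℕ} {a : Fin k → ℕ} (hp : 0 ≤ p) (hρ : 0 ≤ ρ)
    (hU : ρ ^ (2 * (k + 1)) = U) (hm : p ≤ U ^ m) (ha : ∀ i, p ≤ U ^ a i) :
    √p ≤ ρ ^ m * ∏ i, ρ ^ a i := by
  refine (pow_le_pow_iff_left₀ (Real.sqrt_nonneg _) (by positivity)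
    (show 2 * (k + 1) ≠ 0 by omega)).1 ?_
  have hk : p ^ k ≤ ∏ i, U ^ a i := by
    simpa using Finset.prod_le_prod (s := Finset.univ) (fun i _ => hp) fun i _ => ha i
  calc √p ^ (2 * (k + 1)) = p * p ^ k := by
        rw [pow_mul, Real.sq_sqrt hp, pow_succ, mul_comm]
    _ ≤ U ^ m * ∏ i, U ^ a i := mul_le_mul hm hk (by positivity) (hp.trans hm)
    _ = (ρ ^ m * ∏ i, ρ ^ a i) ^ (2 * (k + 1)) := by
        rw [mul_pow, ← Finset.prod_pow, ← hU]
        simp_rw [← pow_mul, mul_comm]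

lemma exists_tendsto_truncAt (hu : u ∈ Set.Ioo (0 : ℝ) 1) (hd : d ∈ Set.Ioo (0 : ℝ) 1) (K : ℕ)
    {j : ℕ} (hj : 1 ≤ j) : ∃ l, Tendsto (truncAt u d K j) atTop (𝓝 l) := by
  obtain ⟨k, rfl⟩ := Nat.exists_eq_add_of_le' hj
  choose q hq using eventually_const_cond hu hd K k
  choose p hp using eventually_const_joint hu hd K k
  set U := stat u d true with hU
  have hU0 : 0 < U := stat_pos hu hd true
  have hU1 : U < 1 := stat_lt_one hu hd true
  set ρ : ℝ := U ^ ((2 * (k + 1) : ℕ) : ℝ)⁻¹ with hρ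
  have hρ0 : 0 ≤ ρ := by positivity
  have hρU : ρ ^ (2 * (k + 1)) = U := Real.rpow_inv_natCast_pow hU0.le (by omega)
  have hρ1 : ρ < 1 := Real.rpow_lt_one hU0.le hU1 (by positivity)
  set bound : ℕ × (Fin k → ℕ) × (Fin K → Bool) → ℝ := fun w =>
    2 * (ρ ^ w.1 * ((∏ i, ρ ^ w.2.1 i) * 1)) with hbound
  have hsum : Summable bound := by
    refine Summable.mul_left 2 ?_
    have h1 : Summable fun _ : Fin K → Bool => (1 : ℝ) := (hasSum_fintype _).summable
    have h2 := (summable_prod_pow hρ0 hρ1 k).mul_of_nonneg h1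
      (fun _ => by dsimp only; positivity) fun _ => by simp
    exact (summable_geometric_of_lt_one hρ0 hρ1).mul_of_nonneg h2 (fun _ => by positivity)
      fun _ => by dsimp only; positivity
  -- Writing `t = r + (k + 1)` makes `r` the time of the revealed `Z`.
  refine ⟨- ∑' w, p w * Real.log (p w / q w.2), (tendsto_add_atTop_iff_nat (k + 1)).1 ?_⟩
  simp only [truncAt, condEntropy, Nat.add_sub_cancel]
  refine (tendsto_tsum_of_dominated_convergence hsum (fun w => ?_) ?_).neg
  · refine Tendsto.congr' ?_ tendsto_const_nhds
    filter_upwards [hp w, hq w.2] with r h1 h2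
    exact (congrArg₂ (fun a b => a * Real.log (a / b)) h1 h2).symm
  · refine Eventually.of_forall fun r w => ?_
    rw [Real.norm_eq_abs]
    refine (abs_mul_log_div_le measureReal_nonneg (measureReal_mono fun ω h => h.2)
      measureReal_le_one).trans ?_
    refine mul_le_mul_of_nonneg_left ?_ zero_le_two
    rw [mul_one]
    refine sqrt_le_of_pow_bounds measureReal_nonneg hρ0 hρU ?_ fun i => ?_
    · refine (measureReal_mono ?_).trans (netLaw_le_M hu hd (r + (k + 1)) _)
      exact fun ω h => h.1.ge
    · refine (measureReal_mono ?_).trans (netLaw_le_M hu hd (r + (k + 1) - 1 - i) _)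
      exact fun ω h => (congrFun (congrArg Prod.fst h.2) i).ge

/-- A sequence that is approximated by convergent sequences converges. -/
lemma exists_tendsto_of_approx {f : ℕ → ℝ} {g : ℕ → ℕ → ℝ} {ε : ℕ → ℝ}
    (hg : ∀ K, 1 ≤ K → ∃ l, Tendsto (g K) atTop (𝓝 l)) (hε : Tendsto ε atTop (𝓝 0))
    (h : ∀ K, 1 ≤ K → ∀ᶠ t in atTop, |f t - g K t| ≤ ε K) : ∃ l, Tendsto f atTop (𝓝 l) := by
  refine cauchySeq_tendsto_of_complete (Metric.cauchySeq_iff'.2 fun δ hδ => ?_)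
  obtain ⟨K, hK, hK1⟩ :=
    ((hε.eventually (gt_mem_nhds (show (0 : ℝ) < δ / 3 by linarith))).and
      (eventually_ge_atTop 1)).exists
  obtain ⟨l, hl⟩ := hg K hK1
  obtain ⟨N₁, hN₁⟩ := eventually_atTop.1 (h K hK1)
  obtain ⟨N₂, hN₂⟩ := Metric.cauchySeq_iff.1 hl.cauchySeq (δ / 3) (by linarith)
  refine ⟨max N₁ N₂, fun n hn => ?_⟩
  have h1 := abs_le.1 (hN₁ n ((le_max_left _ _).trans hn))
  have h2 := abs_le.1 (hN₁ (max N₁ N₂) (le_max_left _ _))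
  have h3 := hN₂ n ((le_max_right _ _).trans hn) (max N₁ N₂) (le_max_right _ _)
  rw [Real.dist_eq, abs_lt] at h3 ⊢
  constructor <;> linarith [h1.1, h1.2, h2.1, h2.2, h3.1, h3.2]

lemma exists_tendsto_upperAt (hu : u ∈ Set.Ioo (0 : ℝ) 1) (hd : d ∈ Set.Ioo (0 : ℝ) 1)
    {j : ℕ} (hj : 1 ≤ j) : ∃ l, Tendsto (upperAt u d j) atTop (𝓝 l) := by
  simp only [funext (upperAt_eq (u := u) (d := d) j)]
  exact exists_tendsto_truncAt hu hd 0 hj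

lemma lowerAt_near (hu : u ∈ Set.Ioo (0 : ℝ) 1) (hd : d ∈ Set.Ioo (0 : ℝ) 1) {j K t : ℕ}
    (hj : 1 ≤ j) (ht : K + j ≤ t) : lowerAt u d j t ≤ truncAt u d K j t ∧
      truncAt u d K j t ≤ lowerAt u d j t +
        memory u d j * (stat u d true ^ K / (1 - stat u d true)) := by
  obtain ⟨n, rfl⟩ := Nat.exists_eq_add_of_le' ht
  rw [lowerAt_eq, show n + (K + j) - j = n + K by omega]
  refine ⟨truncAt_antitone _ _ _ _, ?_⟩
  have := truncAt_le_add hu hd (r := n + K) hj (Nat.le_add_left K n)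
  rwa [add_assoc] at this

/-- The number of revealed coordinates grows with `t`, so dominated convergence is not used
directly: `truncAt` with fixed `K` approximates with an error uniform in `t`. -/
lemma exists_tendsto_lowerAt (hu : u ∈ Set.Ioo (0 : ℝ) 1) (hd : d ∈ Set.Ioo (0 : ℝ) 1)
    {j : ℕ} (hj : 1 ≤ j) : ∃ l, Tendsto (lowerAt u d j) atTop (𝓝 l) := by
  refine exists_tendsto_of_approx (g := fun K => truncAt u d K j)
    (ε := fun K => memory u d j * (stat u d true ^ K / (1 - stat u d true)))
    (fun K _ => exists_tendsto_truncAt hu hd K hj) ?_ fun K _ => ?_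
  · have := ((tendsto_pow_atTop_nhds_zero_of_lt_one (stat_pos hu hd true).le
      (stat_lt_one hu hd true)).div_const (1 - stat u d true)).const_mul (memory u d j)
    simpa using this
  · filter_upwards [eventually_ge_atTop (K + j)] with t ht
    have := lowerAt_near hu hd hj ht
    rw [abs_le]
    constructor <;> linarith

lemma upperAt_le_lowerAt_add (hu : u ∈ Set.Ioo (0 : ℝ) 1) (hd : d ∈ Set.Ioo (0 : ℝ) 1) {j t : ℕ}
    (hj : 1 ≤ j) (ht : j ≤ t) :
    upperAt u d j t ≤ lowerAt u d j t + memory u d j / (1 - stat u d true) := by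
  have := (lowerAt_near hu hd (K := 0) hj (by omega : 0 + j ≤ t)).2
  rwa [pow_zero, mul_one_div, ← upperAt_eq] at this

lemma lowerAt_le_upperAt_self (hu : u ∈ Set.Ioo (0 : ℝ) 1) (hd : d ∈ Set.Ioo (0 : ℝ) 1) {j t : ℕ}
    (hj : 1 ≤ j) (ht : j ≤ t) : lowerAt u d j t ≤ upperAt u d t t := by
  obtain ⟨r, rfl⟩ := Nat.exists_eq_add_of_le' ht
  rw [lowerAt_eq, Nat.add_sub_cancel]
  exact truncAt_le_upperAt_self hu hd hj

lemma tendsto_memory (hu : u ∈ Set.Ioo (0 : ℝ) 1) (hd : d ∈ Set.Ioo (0 : ℝ) 1) :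
    Tendsto (fun j => memory u d j / (1 - stat u d true)) atTop (𝓝 0) := by
  have hr : |1 - u - d| < 1 := abs_lt.2 ⟨by linarith [hu.2, hd.2], by linarith [hu.1, hd.1]⟩
  have := ((tendsto_pow_atTop_nhds_zero_of_lt_one (abs_nonneg _) hr).const_mul
    (stat u d true * stat u d false)⁻¹).div_const (1 - stat u d true)
  simpa [memory] using this

/-- The entropy given the whole past is within `memory u d K / (1 - U)` of the convergent sequence
`upperAt u d K`, for every `K ≥ 1`. -/
lemma exists_tendsto_upperAt_self (hu : u ∈ Set.Ioo (0 : ℝ) 1) (hd : d ∈ Set.Ioo (0 : ℝ) 1) :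
    ∃ l, Tendsto (fun t => upperAt u d t t) atTop (𝓝 l) := by
  refine exists_tendsto_of_approx (fun K hK => exists_tendsto_upperAt hu hd hK)
    (tendsto_memory hu hd) fun K hK => ?_
  filter_upwards [eventually_ge_atTop K] with t ht
  have h1 := upperAt_le_lowerAt_add hu hd hK ht
  have h2 := lowerAt_le_upperAt_self hu hd hK ht
  have h3 := upperAt_antitone (u := u) (d := d) (t := t) ht
  rw [abs_le]
  constructor <;> linarith

lemma entropy_block_succ (t : ℕ) :
    entropy (netLaw u d) (fun ω (i : Fin (t + 1)) => M (t + 1 - i) 1 ω) =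
      entropy (netLaw u d) (fun ω (i : Fin t) => M (t - i) 1 ω) +
        upperAt u d (t + 1) (t + 1) := by
  have hpast : (fun ω (i : Fin t) => M (t - i) 1 ω) = past (t + 1) t := rfl
  rw [hpast]
  refine entropy_chain (FiniteValued.pi fun _ => finiteValued_M _ _) (finiteValued_M _ _)
    (finiteValued_past _ _) fun ω ω' => ?_
  simp only [funext_iff, Fin.forall_fin_succ, Fin.val_zero, Nat.sub_zero, Fin.val_succ,
    Nat.add_sub_add_right]
  rfl

lemma blockRate_eq (t : ℕ) :
    blockRate u d t = (t : ℝ)⁻¹ * ∑ i ∈ Finset.range t, upperAt u d (i + 1) (i + 1) := by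
  rw [blockRate, one_div]
  congr 1
  induction t with
  | zero =>
    rw [entropy, Finset.sum_range_zero, tsum_fintype]
    simp [eq_iff_true_of_subsingleton]
  | succ t ih => rw [entropy_block_succ, ih, Finset.sum_range_succ]

end Limits

end LinearNetwork

end

/-! ### Assembly of the theorem -/

theorem theorem2 (u d : ℝ) (hu : u ∈ Set.Ioo (0 : ℝ) 1) (hd : d ∈ Set.Ioo (0 : ℝ) 1) :
    -- the limits that define the entropy rate and its bounds exist
    Tendsto (LinearNetwork.blockRate u d) atTop (𝓝 (LinearNetwork.entropyRate u d)) ∧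
    (∀ j : ℕ, 1 ≤ j →
      Tendsto (LinearNetwork.upperAt u d j) atTop (𝓝 (LinearNetwork.upperBound u d j)) ∧
      Tendsto (LinearNetwork.lowerAt u d j) atTop (𝓝 (LinearNetwork.lowerBound u d j))) ∧
    -- they are bounds for the entropy rate, and they converge to it exponentially fast
    ∃ C : ℝ, ∀ j : ℕ, 1 ≤ j →
      LinearNetwork.lowerBound u d j ≤ LinearNetwork.entropyRate u d ∧
      LinearNetwork.entropyRate u d ≤ LinearNetwork.upperBound u d j ∧
      LinearNetwork.upperBound u d j - LinearNetwork.lowerBound u d j ≤ C * |1 - u - d| ^ j := by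
  open LinearNetwork in
  have hU : ∀ j, 1 ≤ j → Tendsto (upperAt u d j) atTop (𝓝 (upperBound u d j)) := fun j hj =>
    tendsto_nhds_limUnder (exists_tendsto_upperAt hu hd hj)
  have hL : ∀ j, 1 ≤ j → Tendsto (lowerAt u d j) atTop (𝓝 (lowerBound u d j)) := fun j hj =>
    tendsto_nhds_limUnder (exists_tendsto_lowerAt hu hd hj)
  obtain ⟨h, hh⟩ := exists_tendsto_upperAt_self hu hd
  have hB : Tendsto (blockRate u d) atTop (𝓝 h) := by
    -- By the chain rule, the block rate is the Cesàro mean of the entropies given the whole past.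
    have := ((tendsto_add_atTop_iff_nat 1).2 hh).cesaro
    exact this.congr fun t => (blockRate_eq t).symm
  have hR : entropyRate u d = h := hB.limUnder_eq
  rw [hR]
  refine ⟨hB, fun j hj => ⟨hU j hj, hL j hj⟩,
    -- The relative error per link, without its power of `|1 - u - d|`, times the bound `1 / (1 -
    -- U)` on the expected number of links read.
    (stat u d true * stat u d false)⁻¹ / (1 - stat u d true), fun j hj => ⟨?_, ?_, ?_⟩⟩
  · refine le_of_tendsto_of_tendsto (hL j hj) hh ?_
    filter_upwards [eventually_ge_atTop j] with t ht
    exact lowerAt_le_upperAt_self hu hd hj ht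
  · refine le_of_tendsto_of_tendsto hh (hU j hj) ?_
    filter_upwards [eventually_ge_atTop j] with t ht
    exact upperAt_antitone ht
  · refine le_of_tendsto ((hU j hj).sub (hL j hj)) ?_
    filter_upwards [eventually_ge_atTop j] with t ht
    have := upperAt_le_lowerAt_add hu hd hj ht
    rw [memory, mul_div_right_comm] at this
    linarith
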